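/- Let $n\ge 1$ and let $M$ be a smooth $4n$-dimensional manifold with an almost hypercomplex pseudo-Hermitian structure: smooth fields $J_1,J_2,J_3$ of endomorphisms of $TM$ with $J_\alpha^2=-\mathrm{Id}$ and $J_1J_2=-J_2J_1=J_3$, and a smooth nondegenerate symmetric $(0,2)$-tensor field $g$ with $g(J_1x,J_1y)=-g(J_2x,J_2y)=-g(J_3x,J_3y)=g(x,y)$. Let $\nabla$ be the Levi-Civita connection of $g$, and put $F_\alpha(x,y,z)=g\big((\nabla_xJ_\alpha)y,z\big)$ and $\theta_\alpha(z)=g^{ij}F_\alpha(e_i,e_j,z)$ for $\alpha=1,2,3$. Suppose that $M$ is a $\mathcal W^0$-manifold, i.e. that $$F_1(x,y,z)=\tfrac{1}{2(2n-1)}\big[g(x,y)\theta_1(z)-g(x,z)\theta_1(y)-g(x,J_1y)\theta_1(J_1z)+g(x,J_1z)\theta_1(J_1y)\big],$$ $$F_\alpha(x,y,z)=\tfrac{1}{4n}\big[g(x,y)\theta_\alpha(z)+g(x,z)\theta_\alpha(y)+g(x,J_\alpha y)\theta_\alpha(J_\alpha z)+g(x,J_\alpha z)\theta_\alpha(J_\alpha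 y)\big]\quad(\alpha=2,3),$$ and $d(\theta_1\circ J_1)=0$. Let $R(X,Y)Z=\nabla_X\nabla_YZ-\nabla_Y\nabla_XZ-\nabla_{[X,Y]}Z$ and $R(X,Y,Z,U)=g(R(X,Y)Z,U)$ be the curvature tensor, $\rho(Y,Z)=g^{ij}R(e_i,Y,Z,e_j)$ the Ricci tensor and $\tau=g^{ij}\rho(e_i,e_j)$ the scalar curvature. Then $$R=\frac{1}{2(2n-1)}\Big\{\psi_1(\rho)-\frac{\tau}{4n-1}\,\pi_1\Big\},$$ where, for a symmetric $(0,2)$-tensor $S$, $$\psi_1(S)(X,Y,Z,U)=g(Y,Z)S(X,U)-g(X,Z)S(Y,U)+g(X,U)S(Y,Z)-g(Y,U)S(X,Z),$$ $$\pi_1(X,Y,Z,U)=\tfrac12\psi_1(g)(X,Y,Z,U)=g(Y,Z)g(X,U)-g(X,Z)g(Y,U).$$ Equivalently, the Weyl tensor of $g$, which for a metric in dimension $m$ is $W=R-\frac{1}{m-2}\big\{\psi_1(\rho)-\frac{\tau}{m-1}\pi_1\big\}$, vanishes (here $m=4n$). -/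

import Mathlib

open scoped Manifold ContDiff Bundle

noncomputable section

/-! ## Tensor calculus of a pseudo-Riemannian metric in a coordinate domain of `ℝᵐ`

A tensor field on a coordinate domain is written as a function of the point `x` followed by the
vectors it is evaluated on.  A metric is `g : E → E → E → ℝ`, with `g x v w = g_x(v, w)`. -/

namespace LocalMetric

/-- The `i`-th coordinate vector `∂/∂xⁱ`. -/
abbrev e {m : ℕ} (i : Fin m) : EuclideanSpace ℝ (Fin m) := EuclideanSpace.single i (1 : ℝ)

variable {m : ℕ}

local notation "E" => EuclideanSpace ℝ (Fin m)

/-- The components `g^{ij}` of the inverse metric. -/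
def gInv (g : E → E → E → ℝ) (x : E) (i j : Fin m) : ℝ :=
  (Matrix.of fun a b : Fin m => g x (e a) (e b))⁻¹ i j

/-- The metric contraction `g^{ij} B(e_i, e_j)` of a bilinear form `B`. -/
def metricTrace (g : E → E → E → ℝ) (x : E) (B : E → E → ℝ) : ℝ :=
  ∑ i, ∑ j, gInv g x i j * B (e i) (e j)

/-- Christoffel symbols of the first kind:
`½ (∂_u g(v, w) + ∂_v g(u, w) - ∂_w g(u, v))` for constant vectors `u, v, w`. -/
def christoffel₁ (g : E → E → E → ℝ) (x u v w : E) : ℝ :=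
  (1 / 2) * (fderiv ℝ (fun y => g y v w) x u + fderiv ℝ (fun y => g y u w) x v
    - fderiv ℝ (fun y => g y u v) x w)

/-- Christoffel symbols of the second kind: `Γ(u, v) = ∇_u v` for constant vector fields `u, v`,
where `∇` is the Levi-Civita connection of `g`. -/
def christoffel (g : E → E → E → ℝ) (x u v : E) : E :=
  ∑ k, (∑ l, gInv g x k l * christoffel₁ g x u v (e l)) • e k

/-- `(∇_u J) v = ∇_u (J v) - J (∇_u v)` for a field of endomorphisms `J`, where
`∇_u Y = ∂_u Y + Γ(u, Y)`. -/
def nablaEnd (g : E → E → E → ℝ) (J : E → E → E) (x u v : E) : E :=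
  (fderiv ℝ (fun y => J y v) x u + christoffel g x u (J x v)) - J x (christoffel g x u v)

/-- The structural tensor `F(u, v, w) = g((∇_u J) v, w)`. -/
def structuralTensor (g : E → E → E → ℝ) (J : E → E → E) (x u v w : E) : ℝ :=
  g x (nablaEnd g J x u v) w

/-- The structural 1-form `θ(z) = g^{ij} F(e_i, e_j, z)`. -/
def structuralForm (g : E → E → E → ℝ) (J : E → E → E) (x z : E) : ℝ :=
  metricTrace g x fun u v => structuralTensor g J x u v z

/-- The vanishing of the exterior derivative of the 1-form `α` at `x`:
`dα(u, v) = ∂_u (α(v)) - ∂_v (α(u)) = 0` for constant vectors `u, v`. -/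
def ExtDerivVanishesAt (α : E → E → ℝ) (x : E) : Prop :=
  ∀ u v : E, fderiv ℝ (fun y => α y v) x u - fderiv ℝ (fun y => α y u) x v = 0

/-- The curvature `R(u, v) w = ∇_u ∇_v w - ∇_v ∇_u w - ∇_[u,v] w` on constant vector fields
(for which `[u, v] = 0`). -/
def curvature (g : E → E → E → ℝ) (x u v w : E) : E :=
  (fderiv ℝ (fun y => christoffel g y v w) x u + christoffel g x u (christoffel g x v w))
    - (fderiv ℝ (fun y => christoffel g y u w) x v + christoffel g x v (christoffel g x u w))

/-- The curvature tensor of type (0,4): `R(X, Y, Z, U) = g(R(X, Y) Z, U)`. -/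
def riemann (g : E → E → E → ℝ) (x X Y Z U : E) : ℝ :=
  g x (curvature g x X Y Z) U

/-- The Ricci tensor `ρ(Y, Z) = g^{ij} R(e_i, Y, Z, e_j)`. -/
def ricci (g : E → E → E → ℝ) (x Y Z : E) : ℝ :=
  metricTrace g x fun X U => riemann g x X Y Z U

/-- The scalar curvature `τ = g^{ij} ρ(e_i, e_j)`. -/
def scalarCurvature (g : E → E → E → ℝ) (x : E) : ℝ :=
  metricTrace g x (ricci g x)

/-- `ψ₁(S)(X,Y,Z,U) = g(Y,Z)S(X,U) - g(X,Z)S(Y,U) + g(X,U)S(Y,Z) - g(Y,U)S(X,Z)`. -/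
def psi₁ (g : E → E → E → ℝ) (S : E → E → E → ℝ) (x X Y Z U : E) : ℝ :=
  g x Y Z * S x X U - g x X Z * S x Y U + g x X U * S x Y Z - g x Y U * S x X Z

/-- `π₁(X,Y,Z,U) = g(Y,Z)g(X,U) - g(X,Z)g(Y,U)`. -/
def pi₁ (g : E → E → E → ℝ) (x X Y Z U : E) : ℝ :=
  g x Y Z * g x X U - g x X Z * g x Y U

/-- The Weyl tensor of an `m`-dimensional pseudo-Riemannian metric, as a (0,4)-tensor. -/
def weyl (g : E → E → E → ℝ) (x X Y Z U : E) : ℝ :=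
  riemann g x X Y Z U - 1 / ((m : ℝ) - 2) *
    (psi₁ g (ricci g) x X Y Z U - scalarCurvature g x / ((m : ℝ) - 1) * pi₁ g x X Y Z U)

end LocalMetric

/-! ## Almost hypercomplex pseudo-Hermitian manifolds -/

/-- An almost hypercomplex pseudo-Hermitian structure on a smooth `4n`-dimensional manifold `M`:
a smooth almost hypercomplex structure `H = (J₁, J₂, J₃)` and a smooth nondegenerate symmetric
(0,2)-tensor `g` which is Hermitian with respect to `J₁` and skew-Hermitian with respect to `J₂`
and `J₃`.  The Kähler form `Φ = g(J₁·,·)` and the metrics `g₂ = g(J₂·,·)`, `g₃ = g(J₃·,·)`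
completing `G = (g, Φ, g₂, g₃)` are determined by these data, and so is the neutral signature
`(2n, 2n)` of `g`, as `J₂` is an anti-isometry. -/
structure AlmostHGStructure (n : ℕ) (M : Type*) [TopologicalSpace M]
    [ChartedSpace (EuclideanSpace ℝ (Fin (4 * n))) M] [IsManifold (𝓡 (4 * n)) ∞ M] where
  /-- The metric. -/
  g : ∀ p : M, TangentSpace (𝓡 (4 * n)) p →L[ℝ] TangentSpace (𝓡 (4 * n)) p →L[ℝ] ℝ
  /-- The first almost complex structure. -/
  J₁ : ∀ p : M, TangentSpace (𝓡 (4 * n)) p →L[ℝ] TangentSpace (𝓡 (4 * n)) p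
  /-- The second almost complex structure. -/
  J₂ : ∀ p : M, TangentSpace (𝓡 (4 * n)) p →L[ℝ] TangentSpace (𝓡 (4 * n)) p
  /-- The third almost complex structure. -/
  J₃ : ∀ p : M, TangentSpace (𝓡 (4 * n)) p →L[ℝ] TangentSpace (𝓡 (4 * n)) p
  contMDiff_g : ContMDiff (𝓡 (4 * n))
    ((𝓡 (4 * n)).prod 𝓘(ℝ, EuclideanSpace ℝ (Fin (4 * n)) →L[ℝ]
      EuclideanSpace ℝ (Fin (4 * n)) →L[ℝ] ℝ)) ∞
    (fun p => Bundle.TotalSpace.mk' (EuclideanSpace ℝ (Fin (4 * n)) →L[ℝ]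
      EuclideanSpace ℝ (Fin (4 * n)) →L[ℝ] ℝ)
      (E := fun p : M => TangentSpace (𝓡 (4 * n)) p →L[ℝ] TangentSpace (𝓡 (4 * n)) p →L[ℝ] ℝ)
      p (g p))
  contMDiff_J₁ : ContMDiff (𝓡 (4 * n))
    ((𝓡 (4 * n)).prod 𝓘(ℝ, EuclideanSpace ℝ (Fin (4 * n)) →L[ℝ]
      EuclideanSpace ℝ (Fin (4 * n)))) ∞
    (fun p => Bundle.TotalSpace.mk' (EuclideanSpace ℝ (Fin (4 * n)) →L[ℝ]
      EuclideanSpace ℝ (Fin (4 * n)))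
      (E := fun p : M => TangentSpace (𝓡 (4 * n)) p →L[ℝ] TangentSpace (𝓡 (4 * n)) p) p (J₁ p))
  contMDiff_J₂ : ContMDiff (𝓡 (4 * n))
    ((𝓡 (4 * n)).prod 𝓘(ℝ, EuclideanSpace ℝ (Fin (4 * n)) →L[ℝ]
      EuclideanSpace ℝ (Fin (4 * n)))) ∞
    (fun p => Bundle.TotalSpace.mk' (EuclideanSpace ℝ (Fin (4 * n)) →L[ℝ]
      EuclideanSpace ℝ (Fin (4 * n)))
      (E := fun p : M => TangentSpace (𝓡 (4 * n)) p →L[ℝ] TangentSpace (𝓡 (4 * n)) p) p (J₂ p))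
  contMDiff_J₃ : ContMDiff (𝓡 (4 * n))
    ((𝓡 (4 * n)).prod 𝓘(ℝ, EuclideanSpace ℝ (Fin (4 * n)) →L[ℝ]
      EuclideanSpace ℝ (Fin (4 * n)))) ∞
    (fun p => Bundle.TotalSpace.mk' (EuclideanSpace ℝ (Fin (4 * n)) →L[ℝ]
      EuclideanSpace ℝ (Fin (4 * n)))
      (E := fun p : M => TangentSpace (𝓡 (4 * n)) p →L[ℝ] TangentSpace (𝓡 (4 * n)) p) p (J₃ p))
  J₁_sq : ∀ (p : M) (v : TangentSpace (𝓡 (4 * n)) p), J₁ p (J₁ p v) = -v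
  J₂_sq : ∀ (p : M) (v : TangentSpace (𝓡 (4 * n)) p), J₂ p (J₂ p v) = -v
  J₃_eq : ∀ (p : M) (v : TangentSpace (𝓡 (4 * n)) p), J₃ p v = J₁ p (J₂ p v)
  J₁_J₂ : ∀ (p : M) (v : TangentSpace (𝓡 (4 * n)) p), J₁ p (J₂ p v) = -J₂ p (J₁ p v)
  symm : ∀ (p : M) (v w : TangentSpace (𝓡 (4 * n)) p), g p v w = g p w v
  nondegenerate : ∀ (p : M) (v : TangentSpace (𝓡 (4 * n)) p), (∀ w, g p v w = 0) → v = 0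
  hermitian_J₁ : ∀ (p : M) (v w : TangentSpace (𝓡 (4 * n)) p),
    g p (J₁ p v) (J₁ p w) = g p v w
  skewHermitian_J₂ : ∀ (p : M) (v w : TangentSpace (𝓡 (4 * n)) p),
    g p (J₂ p v) (J₂ p w) = -g p v w
  skewHermitian_J₃ : ∀ (p : M) (v w : TangentSpace (𝓡 (4 * n)) p),
    g p (J₃ p v) (J₃ p w) = -g p v w

namespace AlmostHGStructure

variable {n : ℕ} {M : Type*} [TopologicalSpace M]
  [ChartedSpace (EuclideanSpace ℝ (Fin (4 * n))) M]

local notation "E" => EuclideanSpace ℝ (Fin (4 * n))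

/-- The expression in the chart `φ` of a (0,2)-tensor field `b` on `M`: its pullback by `φ⁻¹`. -/
def localForm (b : ∀ p : M, TangentSpace (𝓡 (4 * n)) p →L[ℝ] TangentSpace (𝓡 (4 * n)) p →L[ℝ] ℝ)
    (φ : OpenPartialHomeomorph M E) (x v w : E) : ℝ :=
  b (φ.symm x) (mfderiv (𝓡 (4 * n)) (𝓡 (4 * n)) φ.symm x v)
    (mfderiv (𝓡 (4 * n)) (𝓡 (4 * n)) φ.symm x w)

/-- The expression in the chart `φ` of a field `J` of endomorphisms of `TM`: `dφ ∘ J ∘ dφ⁻¹`. -/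
def localEnd (J : ∀ p : M, TangentSpace (𝓡 (4 * n)) p →L[ℝ] TangentSpace (𝓡 (4 * n)) p)
    (φ : OpenPartialHomeomorph M E) (x v : E) : E :=
  mfderiv (𝓡 (4 * n)) (𝓡 (4 * n)) φ (φ.symm x)
    (J (φ.symm x) (mfderiv (𝓡 (4 * n)) (𝓡 (4 * n)) φ.symm x v))

variable [IsManifold (𝓡 (4 * n)) ∞ M]

/-- The metric in the chart `φ`. -/
abbrev gLoc (S : AlmostHGStructure n M) (φ : OpenPartialHomeomorph M E) : E → E → E → ℝ :=
  localForm S.g φ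

/-- The class `𝒲(J₁)`: in all local coordinates, and with `F = F₁`, `θ = θ₁`,
`F(x,y,z) = 1/(2(2n-1)) [g(x,y)θ(z) - g(x,z)θ(y) - g(x,J₁y)θ(J₁z) + g(x,J₁z)θ(J₁y)]`. -/
def IsW₁ (S : AlmostHGStructure n M) : Prop :=
  ∀ φ ∈ IsManifold.maximalAtlas (𝓡 (4 * n)) ∞ M, ∀ p ∈ φ.target, ∀ x y z : E,
    let g := S.gLoc φ
    let J := localEnd S.J₁ φ
    let θ := LocalMetric.structuralForm g J
    LocalMetric.structuralTensor g J p x y z = 1 / (2 * (2 * (n : ℝ) - 1)) *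
      (g p x y * θ p z - g p x z * θ p y
        - g p x (J p y) * θ p (J p z) + g p x (J p z) * θ p (J p y))

/-- The class `𝒲(J)` for a skew-Hermitian almost complex structure `J` (here `J₂` or `J₃`): in all
local coordinates, `F` and `θ` being the structural tensor and the structural 1-form of `J`,
`F(x,y,z) = 1/(4n) [g(x,y)θ(z) + g(x,z)θ(y) + g(x,Jy)θ(Jz) + g(x,Jz)θ(Jy)]`. -/
def IsWSkew (S : AlmostHGStructure n M)
    (J : ∀ p : M, TangentSpace (𝓡 (4 * n)) p →L[ℝ] TangentSpace (𝓡 (4 * n)) p) : Prop :=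
  ∀ φ ∈ IsManifold.maximalAtlas (𝓡 (4 * n)) ∞ M, ∀ p ∈ φ.target, ∀ x y z : E,
    let g := S.gLoc φ
    let J := localEnd J φ
    let θ := LocalMetric.structuralForm g J
    LocalMetric.structuralTensor g J p x y z = 1 / (4 * (n : ℝ)) *
      (g p x y * θ p z + g p x z * θ p y
        + g p x (J p y) * θ p (J p z) + g p x (J p z) * θ p (J p y))

/-- The class `𝒲 = 𝒲(J₁) ∩ 𝒲(J₂) ∩ 𝒲(J₃)`. -/
def IsW (S : AlmostHGStructure n M) : Prop :=
  S.IsW₁ ∧ S.IsWSkew S.J₂ ∧ S.IsWSkew S.J₃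

/-- The class `𝒲⁰`: the manifolds of class `𝒲` with `d(θ₁ ∘ J₁) = 0`. -/
def IsW0 (S : AlmostHGStructure n M) : Prop :=
  S.IsW ∧ ∀ φ ∈ IsManifold.maximalAtlas (𝓡 (4 * n)) ∞ M, ∀ p ∈ φ.target,
    LocalMetric.ExtDerivVanishesAt
      (fun y v => LocalMetric.structuralForm (S.gLoc φ) (localEnd S.J₁ φ) y
        (localEnd S.J₁ φ y v)) p

end AlmostHGStructure

end

/-! Work in a chart. For a 1-form `η` with dual vector `P`, let `A(u, v) = η(u) v + η(v) u - g(u, v)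
P`. As `J² = -1`, each class condition says exactly that `∇_u J = [J, A(u, ·)]`, where `η₁ = -c₁ θ₁
∘ J₁` and `η_α = c_α θ_α ∘ J_α` for `α = 2, 3`; the values of the constants `c_α` play no role. The
Leibniz rule for `J₃ = J₁ J₂` ties the three forms together, and linear independence over the
quaternions forces `η₁ = η₂ = η₃ = η` (`quaternionic_forms_eq`).

Hence `Δ = ∇ + A` is a torsion-free connection for which `J₂` and `J₃` are parallel. By hypothesis
`η` is closed, so locally `η = df` and `Δ` is the Levi-Civita connection of `e^{2f} g`. No potential
is chosen: the conformal change formula `connectionCurvature_add_conformalDiff` needs only `dη = 0`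
and gives `R = K + ψ₁(S)`, with `K` the curvature of `Δ` lowered by `g` and `S` the symmetric tensor
`conformalHessian`.

The tensor `K` has the symmetries of a curvature tensor and commutes with `J₂` and `J₃`, which are
self-adjoint for `g`. It is therefore pure for both, and their anticommutation makes it vanish
(`IsCurvatureLike.eq_zero_of_pure`). So `R = ψ₁(S)`, and two contractions express `S` through `ρ`
and `τ` (`riemann_eq_of_eq_psi`). -/

noncomputable section

/-! ### Tensor fields in a chart and their smoothness. -/

namespace AlmostHGStructure

variable {n : ℕ} {M : Type*} [TopologicalSpace M]
  [ChartedSpace (EuclideanSpace ℝ (Fin (4 * n))) M]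

local notation "𝔼" => EuclideanSpace ℝ (Fin (4 * n))

/-- The expression in a chart of a (0,2)-tensor field, as a field of continuous bilinear forms. -/
def localFormL
    (b : ∀ p : M, TangentSpace (𝓡 (4 * n)) p →L[ℝ] TangentSpace (𝓡 (4 * n)) p →L[ℝ] ℝ)
    (φ : OpenPartialHomeomorph M 𝔼) (x : 𝔼) : 𝔼 →L[ℝ] 𝔼 →L[ℝ] ℝ :=
  let D : 𝔼 →L[ℝ] 𝔼 := mfderiv (𝓡 (4 * n)) (𝓡 (4 * n)) φ.symm x
  let B : 𝔼 →L[ℝ] 𝔼 →L[ℝ] ℝ := b (φ.symm x)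
  B.bilinearComp D D

/-- The expression in a chart of a field of endomorphisms, as a field of continuous linear maps. -/
def localEndL (J : ∀ p : M, TangentSpace (𝓡 (4 * n)) p →L[ℝ] TangentSpace (𝓡 (4 * n)) p)
    (φ : OpenPartialHomeomorph M 𝔼) (x : 𝔼) : 𝔼 →L[ℝ] 𝔼 :=
  (mfderiv (𝓡 (4 * n)) (𝓡 (4 * n)) φ (φ.symm x)).comp
    ((J (φ.symm x)).comp (mfderiv (𝓡 (4 * n)) (𝓡 (4 * n)) φ.symm x))

/-- The class conditions are phrased with plain functions, the calculus below with fields of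
continuous linear maps; this definitional equality and the next one carry hypotheses across. -/
theorem localForm_eq
    (b : ∀ p : M, TangentSpace (𝓡 (4 * n)) p →L[ℝ] TangentSpace (𝓡 (4 * n)) p →L[ℝ] ℝ)
    (φ : OpenPartialHomeomorph M 𝔼) :
    localForm b φ = fun x v w => localFormL b φ x v w := rfl

theorem localEnd_eq (J : ∀ p : M, TangentSpace (𝓡 (4 * n)) p →L[ℝ] TangentSpace (𝓡 (4 * n)) p)
    (φ : OpenPartialHomeomorph M 𝔼) :
    localEnd J φ = fun x v => localEndL J φ x v := rfl

theorem mdifferentiable_of_mem_maximalAtlas {φ : OpenPartialHomeomorph M 𝔼}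
    (hφ : φ ∈ IsManifold.maximalAtlas (𝓡 (4 * n)) ∞ M) :
    φ.MDifferentiable (𝓡 (4 * n)) (𝓡 (4 * n)) :=
  ⟨(contMDiffOn_of_mem_maximalAtlas hφ).mdifferentiableOn (by simp),
    (contMDiffOn_symm_of_mem_maximalAtlas hφ).mdifferentiableOn (by simp)⟩

variable [IsManifold (𝓡 (4 * n)) ∞ M]

theorem mfderiv_chart_mfderiv_symm {φ : OpenPartialHomeomorph M 𝔼}
    (hφ : φ ∈ IsManifold.maximalAtlas (𝓡 (4 * n)) ∞ M) {x : 𝔼} (hx : x ∈ φ.target) (v : 𝔼) :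
    mfderiv (𝓡 (4 * n)) (𝓡 (4 * n)) φ (φ.symm x)
      (mfderiv (𝓡 (4 * n)) (𝓡 (4 * n)) φ.symm x v) = v := by
  have : IsManifold (𝓡 (4 * n)) 1 M := .of_le (n := ∞) (by simp)
  exact DFunLike.congr_fun
    ((mdifferentiable_of_mem_maximalAtlas hφ).comp_symm_deriv hx) v

theorem mfderiv_symm_mfderiv_chart {φ : OpenPartialHomeomorph M 𝔼}
    (hφ : φ ∈ IsManifold.maximalAtlas (𝓡 (4 * n)) ∞ M) {x : 𝔼} (hx : x ∈ φ.target)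
    (v : TangentSpace (𝓡 (4 * n)) (φ.symm x)) :
    mfderiv (𝓡 (4 * n)) (𝓡 (4 * n)) φ.symm x
      (mfderiv (𝓡 (4 * n)) (𝓡 (4 * n)) φ (φ.symm x) v) = v := by
  have : IsManifold (𝓡 (4 * n)) 1 M := .of_le (n := ∞) (by simp)
  have h := DFunLike.congr_fun
    ((mdifferentiable_of_mem_maximalAtlas hφ).symm_comp_deriv (φ.map_target hx)) v
  rw [φ.right_inv hx] at h
  exact h

/-- A constant coordinate vector, seen on `M`, is a smooth section along `φ.symm`. Feeding such
sections to a smooth tensor field gives smooth components. -/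
theorem contMDiffOn_mfderiv_symm_apply {φ : OpenPartialHomeomorph M 𝔼}
    (hφ : φ ∈ IsManifold.maximalAtlas (𝓡 (4 * n)) ∞ M) (v : 𝔼) :
    ContMDiffOn (𝓡 (4 * n)) (𝓡 (4 * n)).tangent ∞
      (fun x => (⟨φ.symm x, mfderiv (𝓡 (4 * n)) (𝓡 (4 * n)) φ.symm x v⟩ :
        TangentBundle (𝓡 (4 * n)) M)) φ.target := by
  have : IsManifold (𝓡 (4 * n)) 1 M := .of_le (n := ∞) (by simp)
  have h := (contMDiffOn_symm_of_mem_maximalAtlas hφ).contMDiffOn_tangentMapWithin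
    (m := ∞) (by simp) φ.open_target.uniqueMDiffOn
  have hc : ContMDiffOn (𝓡 (4 * n)) (𝓡 (4 * n)).tangent ∞
      (fun x : 𝔼 => (⟨x, v⟩ : TangentBundle (𝓡 (4 * n)) 𝔼)) φ.target :=
    contMDiffOn_vectorSpace_iff_contDiffOn.2 contDiffOn_const
  refine (h.comp hc (fun x hx => hx)).congr fun x hx => ?_
  simp only [Function.comp_apply, tangentMapWithin]
  rw [mfderivWithin_of_isOpen φ.open_target hx]

theorem contMDiffOn_tangentMap_chart {φ : OpenPartialHomeomorph M 𝔼}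
    (hφ : φ ∈ IsManifold.maximalAtlas (𝓡 (4 * n)) ∞ M)
    {V : ∀ x : 𝔼, TangentSpace (𝓡 (4 * n)) (φ.symm x)}
    (hV : ContMDiffOn (𝓡 (4 * n)) (𝓡 (4 * n)).tangent ∞
      (fun x => (⟨φ.symm x, V x⟩ : TangentBundle (𝓡 (4 * n)) M)) φ.target) :
    ContDiffOn ℝ ∞ (fun x : 𝔼 => (mfderiv (𝓡 (4 * n)) (𝓡 (4 * n)) φ (φ.symm x) (V x) : 𝔼))
      φ.target := by
  have : IsManifold (𝓡 (4 * n)) 1 M := .of_le (n := ∞) (by simp)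
  have h := (contMDiffOn_of_mem_maximalAtlas hφ).contMDiffOn_tangentMapWithin
    (m := ∞) (by simp) φ.open_source.uniqueMDiffOn
  have h2 := ((contMDiff_snd_tangentBundle_modelSpace 𝔼 (𝓡 (4 * n)) (n := ∞)).contMDiffOn
    (s := Set.univ)).comp (h.comp hV (fun x hx => φ.map_target hx)) (fun _ _ => trivial)
  rw [contMDiffOn_iff_contDiffOn] at h2
  refine h2.congr fun x hx => ?_
  have h3 := mfderivWithin_of_isOpen (I := 𝓡 (4 * n)) (I' := 𝓡 (4 * n)) (f := φ)
    φ.open_source (φ.map_target hx)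
  exact (DFunLike.congr_fun h3 (V x)).symm

theorem contDiffOn_localFormL
    {b : ∀ p : M, TangentSpace (𝓡 (4 * n)) p →L[ℝ] TangentSpace (𝓡 (4 * n)) p →L[ℝ] ℝ}
    (hb : ContMDiff (𝓡 (4 * n)) ((𝓡 (4 * n)).prod 𝓘(ℝ, 𝔼 →L[ℝ] 𝔼 →L[ℝ] ℝ)) ∞
      (fun p => Bundle.TotalSpace.mk' (𝔼 →L[ℝ] 𝔼 →L[ℝ] ℝ)
        (E := fun p : M => TangentSpace (𝓡 (4 * n)) p →L[ℝ] TangentSpace (𝓡 (4 * n)) p →L[ℝ] ℝ)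
        p (b p)))
    {φ : OpenPartialHomeomorph M 𝔼} (hφ : φ ∈ IsManifold.maximalAtlas (𝓡 (4 * n)) ∞ M) :
    ContDiffOn ℝ ∞ (localFormL b φ) φ.target := by
  have : IsManifold (𝓡 (4 * n)) 1 M := .of_le (n := ∞) (by simp)
  rw [contDiffOn_clm_apply]
  intro v
  rw [contDiffOn_clm_apply]
  intro w
  have h1 := (hb.contMDiffOn (s := Set.univ)).comp (contMDiffOn_symm_of_mem_maximalAtlas hφ)
    (fun _ _ => trivial)
  have h2 := ContMDiffOn.clm_bundle_apply₂ (E₃ := fun _ : M => ℝ) (F₃ := ℝ) h1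
    (contMDiffOn_mfderiv_symm_apply hφ v)
    (contMDiffOn_mfderiv_symm_apply hφ w)
  intro x hx
  have h3 := (Bundle.contMDiffWithinAt_totalSpace.1 (h2 x hx)).2
  exact h3.contDiffWithinAt

theorem contDiffOn_localEndL
    {J : ∀ p : M, TangentSpace (𝓡 (4 * n)) p →L[ℝ] TangentSpace (𝓡 (4 * n)) p}
    (hJ : ContMDiff (𝓡 (4 * n)) ((𝓡 (4 * n)).prod 𝓘(ℝ, 𝔼 →L[ℝ] 𝔼)) ∞
      (fun p => Bundle.TotalSpace.mk' (𝔼 →L[ℝ] 𝔼)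
        (E := fun p : M => TangentSpace (𝓡 (4 * n)) p →L[ℝ] TangentSpace (𝓡 (4 * n)) p)
        p (J p)))
    {φ : OpenPartialHomeomorph M 𝔼} (hφ : φ ∈ IsManifold.maximalAtlas (𝓡 (4 * n)) ∞ M) :
    ContDiffOn ℝ ∞ (localEndL J φ) φ.target := by
  have : IsManifold (𝓡 (4 * n)) 1 M := .of_le (n := ∞) (by simp)
  rw [contDiffOn_clm_apply]
  intro v
  have h1 := (hJ.contMDiffOn (s := Set.univ)).comp (contMDiffOn_symm_of_mem_maximalAtlas hφ)
    (fun _ _ => trivial)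
  have h2 := ContMDiffOn.clm_bundle_apply h1 (contMDiffOn_mfderiv_symm_apply hφ v)
  exact contMDiffOn_tangentMap_chart hφ h2

end AlmostHGStructure

/-! ## Algebraic curvature tensors and quaternionic structures -/

section Algebra

/-- Multiplying by the conjugate quaternion `a - b J₁ - c J₂ - d J₁J₂` leaves the norm `a² + b² + c²
+ d²` times `y`. -/
theorem quaternion_smul_eq_zero {V : Type*} [AddCommGroup V] [Module ℝ V] {J₁ J₂ : V →ₗ[ℝ] V} (h₁ : ∀ v, J₁ (J₁ v) = -v)
    (h₂ : ∀ v, J₂ (J₂ v) = -v) (h₁₂ : ∀ v, J₂ (J₁ v) = -J₁ (J₂ v)) {y : V} (hy : y ≠ 0)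
    {a b c d : ℝ} (h : a • y + b • J₁ y + c • J₂ y + d • J₁ (J₂ y) = 0) :
    a = 0 ∧ b = 0 ∧ c = 0 ∧ d = 0 := by
  have e₁ := congrArg J₁ h
  have e₂ := congrArg J₂ h
  have e₃ := congrArg (fun v => J₁ (J₂ v)) h
  simp only [map_add, map_smul, map_zero, h₁, h₂, h₁₂, map_neg, neg_neg, smul_neg] at e₁ e₂ e₃
  have key : (a ^ 2 + b ^ 2 + c ^ 2 + d ^ 2) • y = 0 := by
    linear_combination (norm := module) a • h - b • e₁ - c • e₂ - d • e₃
  have := (smul_eq_zero.1 key).resolve_right hy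
  refine ⟨?_, ?_, ?_, ?_⟩ <;> nlinarith [sq_nonneg a, sq_nonneg b, sq_nonneg c, sq_nonneg d]

variable {V : Type*}

/-- The symmetries of a curvature tensor `K(x, y, z, u)`. -/
structure IsCurvatureLike (K : V → V → V → V → ℝ) : Prop where
  skew_left : ∀ x y z u, K x y z u = -K y x z u
  skew_right : ∀ x y z u, K x y z u = -K x y u z
  bianchi : ∀ x y z u, K x y z u + K y z x u + K z x y u = 0

namespace IsCurvatureLike

variable {K : V → V → V → V → ℝ} (hK : IsCurvatureLike K)
include hK

/-- The classical octahedron argument: four cyclic sums combined with the two skew symmetries. -/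
theorem pair_symm (x y z u : V) : K x y z u = K z u x y := by
  have b₁ := hK.bianchi x y z u
  have b₂ := hK.bianchi y z u x
  have b₃ := hK.bianchi z u x y
  have b₄ := hK.bianchi u x y z
  linarith [hK.skew_right x y z u, hK.skew_right y z x u, hK.skew_right z x y u,
    hK.skew_right z u y x, hK.skew_right u y z x, hK.skew_right u x z y,
    hK.skew_left z x y u, hK.skew_left z x u y, hK.skew_left y u z x, hK.skew_left x z u y,
    hK.skew_left y u x z, hK.skew_left x u y z, hK.skew_left u x y z, hK.skew_left x y u z,
    hK.skew_left u x z y, hK.skew_right u y x z, hK.skew_left u y x z, hK.skew_left u y z x,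
    hK.skew_right x z u y, hK.skew_right y u z x]

/-- A curvature tensor for which `J` is symmetric on the last two slots is pure. -/
theorem pure {J : V → V} (hJ : ∀ x y z u, K x y (J z) u = K x y z (J u)) (x y z u : V) :
    K (J x) y z u = K x (J y) z u ∧ K (J x) y z u = K x y (J z) u := by
  -- Pair symmetry moves the symmetry of `J` from the last two slots to the first two.
  have h12 : ∀ x y z u, K (J x) y z u = K x (J y) z u := fun x y z u => by
    rw [hK.pair_symm, hJ, hK.pair_symm]
  refine ⟨h12 x y z u, ?_⟩
  -- Let `A, B, C` be the three cyclic terms with `J` in the third slot and `A', B', C'` those with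
  -- `J` in the first pair. The Bianchi identities read `A + B + C = 0`, `A + B' + C' = 0`, `A' + B
  -- + C' = 0`, `A' + B' + C = 0`; their sum gives `A' + B' + C' = 0`, hence `A = A'`.
  linarith [hK.bianchi x y z (J u), hJ x y z u, hJ y z x u, hJ z x y u,
    hK.bianchi x y (J z) u, hK.bianchi (J x) y z u, hK.bianchi x (J y) z u,
    h12 x y z u, h12 y z x u, h12 z x y u]

/-- A curvature tensor that is pure with respect to `J₂` and `J₃` vanishes, if `J₂` and `J₃`
anticommute and have invertible product. -/
theorem eq_zero_of_pure [Neg V] {J₂ J₃ : V → V}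
    (h₂ : ∀ x y z u, K x y (J₂ z) u = K x y z (J₂ u))
    (h₃ : ∀ x y z u, K x y (J₃ z) u = K x y z (J₃ u))
    (h₂₃ : ∀ v, J₃ (J₂ v) = -J₂ (J₃ v)) (hsurj : ∀ v, ∃ w, J₂ (J₃ w) = v)
    (hneg : ∀ x y z u, K (-x) y z u = -K x y z u) (x y z u : V) : K x y z u = 0 := by
  obtain ⟨w, rfl⟩ := hsurj x
  have p₂ := fun x y z u => (hK.pure h₂ x y z u).2
  have p₃ := fun x y z u => (hK.pure h₃ x y z u).2
  have q₂ := fun x y z u => (hK.pure h₂ x y z u).1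
  have q₃ := fun x y z u => (hK.pure h₃ x y z u).1
  have e₁ : K (J₂ (J₃ w)) y z u = K w y (J₃ (J₂ z)) u := by rw [p₂, p₃]
  -- Carrying `J₂` and `J₃` one at a time through other slots reverses their order on return to the
  -- first slot, so `K` equals its own negative.
  have e₂ : K w y (J₃ (J₂ z)) u = K w (J₂ (J₃ y)) z u := by
    rw [← p₃, q₃, ← p₂, q₂]
  have e₃ : K w (J₂ (J₃ y)) z u = K (J₃ (J₂ w)) y z u := by rw [← q₂, ← q₃]
  rw [h₂₃, hneg] at e₃
  linarith

end IsCurvatureLike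

end Algebra

/-! ### Comparison of the three 1-forms. -/

section ConformalDifference

variable {E : Type*} [NormedAddCommGroup E] [NormedSpace ℝ E]

/-- The difference `A(u, v) = η(u) v + η(v) u - g(u, v) P` of the Levi-Civita connections of two
conformal metrics; `P` is the vector dual to the 1-form `η`. -/
def conformalDiff (g : E →L[ℝ] E →L[ℝ] ℝ) (η : E →L[ℝ] ℝ) (P u v : E) : E :=
  η u • v + η v • u - g u v • P

theorem quaternionic_forms_eq {g : E →L[ℝ] E →L[ℝ] ℝ} (hs : ∀ v w, g v w = g w v)
    (hnd : ∀ v, (∀ w, g v w = 0) → v = 0) {J₁ J₂ J₃ : E →L[ℝ] E}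
    (h₁ : ∀ v, J₁ (J₁ v) = -v) (h₂ : ∀ v, J₂ (J₂ v) = -v) (h₃ : ∀ v, J₃ v = J₁ (J₂ v))
    (h₁₂ : ∀ v, J₂ (J₁ v) = -J₁ (J₂ v))
    (g₁ : ∀ v w, g (J₁ v) w = -g v (J₁ w)) (g₂ : ∀ v w, g (J₂ v) w = g v (J₂ w))
    {η₁ η₂ η₃ : E →L[ℝ] ℝ} {P₁ P₂ P₃ : E}
    (hP₁ : ∀ v, g P₁ v = η₁ v) (hP₂ : ∀ v, g P₂ v = η₂ v) (hP₃ : ∀ v, g P₃ v = η₃ v)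
    (h : ∀ u v, conformalDiff g η₃ P₃ u (J₃ v) - J₃ (conformalDiff g η₃ P₃ u v) =
      conformalDiff g η₁ P₁ u (J₁ (J₂ v)) - J₁ (conformalDiff g η₁ P₁ u (J₂ v)) +
        J₁ (conformalDiff g η₂ P₂ u (J₂ v) - J₂ (conformalDiff g η₂ P₂ u v))) :
    η₁ = η₃ ∧ η₂ = η₃ := by
  -- In each commutator the terms with `η(u)` cancel, so the rest depends on `u = x` through `g(x,
  -- ·)` only. Pairing with `J₁ y` keeps all vectors in the quaternionic span of `y`.
  have key : ∀ y : E, (η₂ (J₂ y) - η₁ (J₂ y) + η₂ (J₂ y) - η₃ (J₂ y)) • y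
      + (η₁ (J₁ (J₂ y)) - η₃ (J₁ (J₂ y))) • J₁ y + (η₁ y + η₃ y - 2 * η₂ y) • J₂ y
      + (η₃ (J₁ y) - η₁ (J₁ y)) • J₁ (J₂ y) = 0 := by
    intro y
    refine hnd _ fun x => ?_
    rw [hs]
    have hx := congrArg (fun v => g v (J₁ y)) (h x y)
    simp only [conformalDiff, h₃, map_add, map_sub, map_smul, add_apply,
      sub_apply, smul_apply, smul_eq_mul, g₁, g₂, h₁,
      hP₁, hP₂, hP₃, map_neg, neg_neg] at hx ⊢
    linear_combination -hx
  have hy : ∀ y : E, η₁ y = η₃ y ∧ η₂ y = η₃ y := by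
    intro y
    by_cases h0 : y = 0
    · simp [h0]
    have h3 : J₁ (J₂ y) ≠ 0 := fun h => h0 <| by
      have := congrArg (fun v => J₁ (J₂ v)) h
      simpa [h₁, h₂, h₁₂] using this
    -- At the point `J₁J₂y` the coefficient of `J₁` becomes `η₃(y) - η₁(y)`; at `y` itself the
    -- coefficient of `J₂` gives `η₁ + η₃ = 2 η₂`.
    obtain ⟨-, hb, -, -⟩ := quaternion_smul_eq_zero (J₁ := J₁.toLinearMap) (J₂ := J₂.toLinearMap)
      h₁ h₂ h₁₂ h3 (key _)
    obtain ⟨-, -, hc, -⟩ := quaternion_smul_eq_zero (J₁ := J₁.toLinearMap) (J₂ := J₂.toLinearMap)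
      h₁ h₂ h₁₂ h0 (key y)
    simp only [h₁, h₂, h₁₂, map_neg, neg_neg] at hb hc
    constructor <;> linarith
  exact ⟨ContinuousLinearMap.ext fun y => (hy y).1, ContinuousLinearMap.ext fun y => (hy y).2⟩

end ConformalDifference

/-! ## Curvature of a connection on a domain of a vector space -/

section Connection

set_option maxSynthPendingDepth 3

open Filter Topology

variable {E F : Type*} [NormedAddCommGroup E] [NormedSpace ℝ E] [NormedAddCommGroup F]
  [NormedSpace ℝ F]

/-- The curvature on constant vector fields of the connection `∇_u Y = ∂_u Y + Γ(u, Y)`. -/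
def connectionCurvature (Γ : E → E →L[ℝ] E →L[ℝ] E) (p u v w : E) : E :=
  (fderiv ℝ Γ p u v w + Γ p u (Γ p v w)) - (fderiv ℝ Γ p v u w + Γ p v (Γ p u w))

theorem hasFDerivAt_clm_apply₂ {B : E → E →L[ℝ] E →L[ℝ] F} {B' : E →L[ℝ] E →L[ℝ] E →L[ℝ] F}
    {p : E} (hB : HasFDerivAt B B' p) (v w : E) :
    HasFDerivAt (fun x => B x v w) ((B'.flip v).flip w) p := by
  convert (hB.clm_apply (hasFDerivAt_const v p)).clm_apply (hasFDerivAt_const w p) using 1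
  ext u
  simp

theorem fderiv_clm_apply₂ {B : E → E →L[ℝ] E →L[ℝ] F} {p : E} (hB : DifferentiableAt ℝ B p)
    (u v w : E) : fderiv ℝ (fun x => B x v w) p u = fderiv ℝ B p u v w := by
  rw [(hasFDerivAt_clm_apply₂ hB.hasFDerivAt v w).fderiv]
  simp

/-- Integrability in the form used twice below: a first-order equation `∂_v f = D v` is
differentiated again, and symmetry of second derivatives yields a curvature identity. The mixed
products of Christoffel terms are symmetric in the two directions and drop out. -/
theorem fderiv_directional_symm {f : E → F} {p : E} (hf : ContDiffAt ℝ 2 f p) {D : E → E → F}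
    (hD : ∀ᶠ x in 𝓝 p, ∀ v, fderiv ℝ f x v = D v x) (u v : E) :
    fderiv ℝ (D v) p u = fderiv ℝ (D u) p v := by
  have hdiff : DifferentiableAt ℝ (fderiv ℝ f) p :=
    (hf.fderiv_right (m := 1) (by norm_num)).differentiableAt one_ne_zero
  have key : ∀ u v, fderiv ℝ (D v) p u = fderiv ℝ (fderiv ℝ f) p u v := by
    intro u v
    have h : D v =ᶠ[𝓝 p] fun x => fderiv ℝ f x v := hD.mono fun x hx => (hx v).symm
    rw [h.fderiv_eq, fderiv_clm_apply hdiff (differentiableAt_const v)]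
    simp
  rw [key, key]
  exact (hf.isSymmSndFDerivAt (by simp)) u v

theorem connectionCurvature_bianchi {Γ : E → E →L[ℝ] E →L[ℝ] E} {p : E}
    (hΓ : DifferentiableAt ℝ Γ p) (hsymm : ∀ᶠ x in 𝓝 p, ∀ u v, Γ x u v = Γ x v u) (u v w : E) :
    connectionCurvature Γ p u v w + connectionCurvature Γ p v w u
      + connectionCurvature Γ p w u v = 0 := by
  have hd : ∀ a u v, fderiv ℝ Γ p a u v = fderiv ℝ Γ p a v u := by
    intro a u v
    rw [← fderiv_clm_apply₂ hΓ, ← fderiv_clm_apply₂ hΓ]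
    have h : (fun x => Γ x u v) =ᶠ[𝓝 p] fun x => Γ x v u := hsymm.mono fun x hx => hx u v
    rw [h.fderiv_eq]
  have hp := hsymm.self_of_nhds
  simp only [connectionCurvature]
  rw [hd u v w, hd v w u, hd w u v, hp v w, hp w u, hp u v]
  abel

/-- The curvature of a connection preserving the metric `G` is skew-adjoint. -/
theorem connectionCurvature_skew {Γ : E → E →L[ℝ] E →L[ℝ] E} {G : E → E →L[ℝ] E →L[ℝ] ℝ} {p : E}
    (hΓ : DifferentiableAt ℝ Γ p) (hG : ContDiffAt ℝ 2 G p)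
    (hpar : ∀ᶠ x in 𝓝 p, ∀ u v w,
      fderiv ℝ G x u v w = G x (Γ x u v) w + G x v (Γ x u w)) (u v w z : E) :
    G p (connectionCurvature Γ p u v w) z = -G p w (connectionCurvature Γ p u v z) := by
  have hp := hpar.self_of_nhds
  have hGd := hG.differentiableAt two_ne_zero
  have hev : ∀ᶠ x in 𝓝 p, ∀ u, fderiv ℝ (fun y => G y w z) x u =
      G x (Γ x u w) z + G x w (Γ x u z) := by
    filter_upwards [hpar, hG.eventually (by simp)] with x hx hGx u
    rw [fderiv_clm_apply₂ (hGx.differentiableAt two_ne_zero), hx]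
  have hsymm := fderiv_directional_symm (f := fun y => G y w z)
    (hG.clm_apply contDiffAt_const |>.clm_apply contDiffAt_const)
    (D := fun u x => G x (Γ x u w) z + G x w (Γ x u z)) hev u v
  have key : ∀ u v, fderiv ℝ (fun x => G x (Γ x v w) z + G x w (Γ x v z)) p u =
      G p (Γ p u (Γ p v w)) z + G p (Γ p v w) (Γ p u z) + G p (fderiv ℝ Γ p u v w) z
      + (G p (Γ p u w) (Γ p v z) + G p w (Γ p u (Γ p v z)) + G p w (fderiv ℝ Γ p u v z)) := by
    intro u v
    have d1 := (hGd.hasFDerivAt.clm_apply (hasFDerivAt_clm_apply₂ hΓ.hasFDerivAt v w)).clm_apply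
      (hasFDerivAt_const z p)
    have d2 := (hGd.hasFDerivAt.clm_apply (hasFDerivAt_const w p)).clm_apply
      (hasFDerivAt_clm_apply₂ hΓ.hasFDerivAt v z)
    refine (DFunLike.congr_fun (d1.add d2).fderiv u).trans ?_
    simp only [add_apply, ContinuousLinearMap.comp_apply, ContinuousLinearMap.flip_apply, hp,
      zero_apply, map_zero]
    ring
  rw [key, key] at hsymm
  simp only [connectionCurvature, map_sub, map_add, sub_apply, add_apply]
  linear_combination hsymm

/-- The curvature of a connection for which `J` is parallel commutes with `J`. -/
theorem connectionCurvature_comm {Γ : E → E →L[ℝ] E →L[ℝ] E} {J : E → E →L[ℝ] E} {p : E}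
    (hΓ : DifferentiableAt ℝ Γ p) (hJ : ContDiffAt ℝ 2 J p)
    (hpar : ∀ᶠ x in 𝓝 p, ∀ u v, fderiv ℝ J x u v = J x (Γ x u v) - Γ x u (J x v)) (u v w : E) :
    connectionCurvature Γ p u v (J p w) = J p (connectionCurvature Γ p u v w) := by
  have hp := hpar.self_of_nhds
  have hJd := hJ.differentiableAt two_ne_zero
  have hev : ∀ᶠ x in 𝓝 p, ∀ u, fderiv ℝ (fun y => J y w) x u =
      J x (Γ x u w) - Γ x u (J x w) := by
    filter_upwards [hpar, hJ.eventually (by simp)] with x hx hJx u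
    rw [fderiv_clm_apply (hJx.differentiableAt two_ne_zero) (differentiableAt_const w), ← hx]
    simp
  have hsymm := fderiv_directional_symm (f := fun y => J y w)
    (hJ.clm_apply contDiffAt_const) (D := fun u x => J x (Γ x u w) - Γ x u (J x w)) hev u v
  have key : ∀ u v, fderiv ℝ (fun x => J x (Γ x v w) - Γ x v (J x w)) p u =
      J p (Γ p u (Γ p v w)) - Γ p u (J p (Γ p v w)) + J p (fderiv ℝ Γ p u v w)
      - (fderiv ℝ Γ p u v (J p w) + Γ p v (J p (Γ p u w)) - Γ p v (Γ p u (J p w))) := by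
    intro u v
    have d1 := hJd.hasFDerivAt.clm_apply (hasFDerivAt_clm_apply₂ hΓ.hasFDerivAt v w)
    have d2 := (hΓ.hasFDerivAt.clm_apply (hasFDerivAt_const v p)).clm_apply
      (hJd.hasFDerivAt.clm_apply (hasFDerivAt_const w p))
    refine (DFunLike.congr_fun (d1.sub d2).fderiv u).trans ?_
    simp only [add_apply, sub_apply, ContinuousLinearMap.comp_apply,
      ContinuousLinearMap.flip_apply, hp, zero_apply, map_zero, zero_add, map_sub]
    abel
  rw [key, key] at hsymm
  simp only [connectionCurvature, map_sub, map_add]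
  rw [← sub_eq_zero] at hsymm ⊢
  rw [← neg_eq_zero, ← hsymm]
  abel

/-- The symmetric tensor `∇η - η ⊗ η + ½ |η|² g` of a 1-form `η`, the correction of the Schouten
tensor in a conformal change of the metric `G`. -/
def conformalHessian (G : E → E →L[ℝ] E →L[ℝ] ℝ) (Γ : E → E →L[ℝ] E →L[ℝ] E)
    (η : E → E →L[ℝ] ℝ) (P : E → E) (p : E) : E →L[ℝ] E →L[ℝ] ℝ :=
  fderiv ℝ η p - (ContinuousLinearMap.compL ℝ E E ℝ (η p)).comp (Γ p)
    - (η p).smulRight (η p) + (1 / 2 * η p (P p)) • G p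

theorem conformalHessian_apply (G : E → E →L[ℝ] E →L[ℝ] ℝ) (Γ : E → E →L[ℝ] E →L[ℝ] E)
    (η : E → E →L[ℝ] ℝ) (P : E → E) (p u v : E) :
    conformalHessian G Γ η P p u v =
      fderiv ℝ η p u v - η p (Γ p u v) - η p u * η p v + 1 / 2 * η p (P p) * G p u v := by
  simp [conformalHessian]

/-- The change of the curvature under a conformal change of the connection. -/
theorem connectionCurvature_add_conformalDiff {Γ Δ : E → E →L[ℝ] E →L[ℝ] E}
    {G : E → E →L[ℝ] E →L[ℝ] ℝ} {η : E → E →L[ℝ] ℝ} {P : E → E} {p : E}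
    (hΓ : DifferentiableAt ℝ Γ p) (hΔ : DifferentiableAt ℝ Δ p) (hG : DifferentiableAt ℝ G p)
    (hη : DifferentiableAt ℝ η p) (hP : DifferentiableAt ℝ P p)
    (hs : ∀ v w, G p v w = G p w v) (htors : ∀ u v, Γ p u v = Γ p v u)
    (hpar : ∀ u v w, fderiv ℝ G p u v w = G p (Γ p u v) w + G p v (Γ p u w))
    (hGP : ∀ᶠ x in 𝓝 p, ∀ v, G x (P x) v = η x v)
    (hclosed : ∀ u v, fderiv ℝ η p u v = fderiv ℝ η p v u)
    (hdiff : ∀ᶠ x in 𝓝 p, ∀ u v, Δ x u v = Γ x u v + conformalDiff (G x) (η x) (P x) u v)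
    (u v w z : E) :
    G p (connectionCurvature Δ p u v w) z = G p (connectionCurvature Γ p u v w) z -
      (G p v w * conformalHessian G Γ η P p u z - G p u w * conformalHessian G Γ η P p v z
        + G p u z * conformalHessian G Γ η P p v w
        - G p v z * conformalHessian G Γ η P p u w) := by
  have hp := hdiff.self_of_nhds
  have hGPp := hGP.self_of_nhds
  -- The derivative of `P` is known only after lowering by `G`, from `G(P, b) = η(b)`; the formula
  -- to be proved never needs more.
  have hdP : ∀ a b, G p (fderiv ℝ P p a) b =
      fderiv ℝ η p a b - G p (Γ p a (P p)) b - η p (Γ p a b) := by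
    intro a b
    have h : (fun x => G x (P x) b) =ᶠ[𝓝 p] fun x => η x b := hGP.mono fun x hx => hx b
    have h' : fderiv ℝ (fun x => G x (P x) b) p a = fderiv ℝ (fun x => η x b) p a := by
      rw [h.fderiv_eq]
    rw [((hG.hasFDerivAt.clm_apply hP.hasFDerivAt).clm_apply (hasFDerivAt_const b p)).fderiv,
      (hη.hasFDerivAt.clm_apply (hasFDerivAt_const b p)).fderiv] at h'
    simp only [add_apply, ContinuousLinearMap.comp_apply, ContinuousLinearMap.flip_apply, hpar,
      zero_apply, map_zero, hGPp] at h'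
    linear_combination h'
  have hdΔ : ∀ a b c, fderiv ℝ Δ p a b c = fderiv ℝ Γ p a b c + fderiv ℝ η p a b • c
      + fderiv ℝ η p a c • b - (G p (Γ p a b) c + G p b (Γ p a c)) • P p
      - G p b c • fderiv ℝ P p a := by
    intro a b c
    have h : (fun x => Δ x b c) =ᶠ[𝓝 p]
        fun x => Γ x b c + (η x b • c + η x c • b - G x b c • P x) := hdiff.mono fun x hx => hx b c
    have hηa : ∀ b, HasFDerivAt (fun x => η x b) ((fderiv ℝ η p).flip b) p := fun b =>
      (hη.hasFDerivAt.clm_apply (hasFDerivAt_const b p)).congr_fderiv (by ext; simp)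
    have hR := (hasFDerivAt_clm_apply₂ hΓ.hasFDerivAt b c).add
      ((((hηa b).smul_const c).add ((hηa c).smul_const b)).sub
        ((hasFDerivAt_clm_apply₂ hG.hasFDerivAt b c).smul hP.hasFDerivAt))
    rw [← fderiv_clm_apply₂ hΔ, h.fderiv_eq]
    refine (DFunLike.congr_fun hR.fderiv a).trans ?_
    simp only [add_apply, sub_apply, smul_apply, ContinuousLinearMap.smulRight_apply,
      ContinuousLinearMap.flip_apply, hpar]
    module
  simp only [connectionCurvature, hdΔ, hp, conformalDiff, conformalHessian_apply, map_add, map_sub,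
    map_smul, add_apply, sub_apply, smul_apply, smul_eq_mul, hdP, hGPp]
  rw [hclosed v u, htors v u]
  simp only [hs (Γ p _ _), hs _ (P p), hGPp, hs v u]
  ring

end Connection

/-! ### Metric duality and traces. -/

namespace LocalMetric

variable {m : ℕ}

local notation "𝔼" m:max => EuclideanSpace ℝ (Fin m)

/-- The components of a field of bilinear forms, as a function of a point and two vectors. -/
abbrev form (G : (𝔼 m) → (𝔼 m) →L[ℝ] (𝔼 m) →L[ℝ] ℝ) : (𝔼 m) → (𝔼 m) → (𝔼 m) → ℝ := fun x v w => G x v w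

theorem sum_smul_e (v : (𝔼 m)) : ∑ i, v i • e i = v := by
  ext j
  simp [Finset.sum_apply, Pi.single_apply]

theorem clm_ext_e {F : Type*} [NormedAddCommGroup F] [NormedSpace ℝ F] {f f' : (𝔼 m) →L[ℝ] F}
    (h : ∀ i, f (e i) = f' (e i)) : f = f' := by
  ext v
  rw [← sum_smul_e v]
  simp only [map_sum, map_smul, h]

section Pointwise

variable {G : (𝔼 m) → (𝔼 m) →L[ℝ] (𝔼 m) →L[ℝ] ℝ} {x : (𝔼 m)}

/-- A null vector of the Gram matrix would be orthogonal to every basis vector. -/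
theorem gram_det_ne_zero (hnd : ∀ v, (∀ w, G x v w = 0) → v = 0) :
    (Matrix.of fun a b : Fin m => form G x (e a) (e b)).det ≠ 0 := by
  intro h
  obtain ⟨v, hv, hM⟩ := Matrix.exists_vecMul_eq_zero_iff.2 h
  apply hv
  have h0 : (∑ i, v i • e i : (𝔼 m)) = 0 := by
    apply hnd
    intro w
    have : G x (∑ i, v i • e i) = 0 := clm_ext_e fun j => by
      have := congrFun hM j
      simpa [Matrix.vecMul, dotProduct] using this
    rw [this]
    rfl
  funext j
  have := congrArg (fun u : (𝔼 m) => u j) h0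
  simpa [Finset.sum_apply, Pi.single_apply] using this

/-- The vector `α^♯ = g^{kl} α(e_l) e_k` dual to a 1-form `α`. -/
def sharp (G : (𝔼 m) → (𝔼 m) →L[ℝ] (𝔼 m) →L[ℝ] ℝ) (x : (𝔼 m)) : ((𝔼 m) →L[ℝ] ℝ) →L[ℝ] (𝔼 m) :=
  ∑ k, ∑ l, gInv (form G) x k l • (ContinuousLinearMap.apply ℝ ℝ (e l : (𝔼 m))).smulRight (e k : (𝔼 m))

theorem sharp_apply (α : (𝔼 m) →L[ℝ] ℝ) :
    sharp G x α = ∑ k, (∑ l, gInv (form G) x k l * α (e l)) • e k := by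
  simp [sharp, Finset.sum_smul, mul_smul]

variable (hs : ∀ v w, G x v w = G x w v) (hnd : ∀ v, (∀ w, G x v w = 0) → v = 0)
include hs hnd

theorem apply_sharp (α : (𝔼 m) →L[ℝ] ℝ) : G x (sharp G x α) = α := by
  refine clm_ext_e fun j => ?_
  set M := Matrix.of fun a b : Fin m => form G x (e a) (e b) with hM
  have hdet : IsUnit M.det := isUnit_iff_ne_zero.2 (gram_det_ne_zero hnd)
  have h : ∀ l, ∑ k, M j k * gInv (form G) x k l = (1 : Matrix (Fin m) (Fin m) ℝ) j l :=
    fun l => congrFun (congrFun (Matrix.mul_nonsing_inv M hdet) j) l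
  calc G x (sharp G x α) (e j)
      = ∑ k, ∑ l, M j k * gInv (form G) x k l * α (e l) := by
        simp only [sharp_apply, map_sum, map_smul, sum_apply, smul_apply, smul_eq_mul,
          Finset.sum_mul]
        refine Finset.sum_congr rfl fun k _ => Finset.sum_congr rfl fun l _ => ?_
        rw [hs (e k) (e j)]
        simp only [hM, Matrix.of_apply]
        ring
    _ = ∑ l, (1 : Matrix (Fin m) (Fin m) ℝ) j l * α (e l) := by
        rw [Finset.sum_comm]
        simp only [← Finset.sum_mul, h]
    _ = α (e j) := by simp [Matrix.one_apply]

theorem sharp_apply_apply (v : (𝔼 m)) : sharp G x (G x v) = v := by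
  rw [← sub_eq_zero]
  refine hnd _ fun w => ?_
  rw [map_sub, apply_sharp hs hnd, sub_self]
  rfl

omit hs hnd in
-- Evaluates the mixed terms `g(X, Z) S(Y, U)` when `ψ₁(S)` is contracted.
theorem metricTrace_mul (α β : (𝔼 m) →L[ℝ] ℝ) :
    metricTrace (form G) x (fun u v => α u * β v) = α (sharp G x β) := by
  simp only [metricTrace, sharp_apply, map_sum, map_smul, smul_eq_mul, Finset.sum_mul]
  exact Finset.sum_congr rfl fun i _ => Finset.sum_congr rfl fun j _ => by ring

theorem metricTrace_self : metricTrace (form G) x (form G x) = m := by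
  set M := Matrix.of fun a b : Fin m => form G x (e a) (e b) with hM
  have hdet : IsUnit M.det := isUnit_iff_ne_zero.2 (gram_det_ne_zero hnd)
  have h : ∀ i, ∑ j, gInv (form G) x i j * M j i = (1 : Matrix (Fin m) (Fin m) ℝ) i i :=
    fun i => congrFun (congrFun (Matrix.nonsing_inv_mul M hdet) i) i
  calc metricTrace (form G) x (form G x) = ∑ i, ∑ j, gInv (form G) x i j * M j i := by
        refine Finset.sum_congr rfl fun i _ => Finset.sum_congr rfl fun j _ => ?_
        rw [hM, Matrix.of_apply, form, hs]
    _ = m := by simp [h]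

/-- If the curvature is `ψ₁(S)` for a symmetric form `S`, then it is determined by its traces. -/
theorem riemann_eq_of_eq_psi {S : (𝔼 m) →L[ℝ] (𝔼 m) →L[ℝ] ℝ} (hS : ∀ v w, S v w = S w v)
    (hm : 2 < m)
    (h : ∀ X Y Z U, riemann (form G) x X Y Z U = psi₁ (form G) (fun _ v w => S v w) x X Y Z U)
    (X Y Z U : (𝔼 m)) :
    riemann (form G) x X Y Z U = 1 / ((m : ℝ) - 2) *
      (psi₁ (form G) (ricci (form G)) x X Y Z U
        - scalarCurvature (form G) x / ((m : ℝ) - 1) * pi₁ (form G) x X Y Z U) := by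
  set s := metricTrace (form G) x (fun v w => S v w) with hs_def
  have hadd : ∀ (B : (𝔼 m) → (𝔼 m) → ℝ) (B' : (𝔼 m) → (𝔼 m) → ℝ) (a b : ℝ),
      metricTrace (form G) x (fun u v => a * B u v + b * B' u v) =
        a * metricTrace (form G) x B + b * metricTrace (form G) x B' := by
    intro B B' a b
    simp only [metricTrace, Finset.mul_sum, ← Finset.sum_add_distrib]
    exact Finset.sum_congr rfl fun i _ => Finset.sum_congr rfl fun j _ => by ring
  -- Contracting `ψ₁(S)` once gives `ρ = s g + (m - 2) S` with `s` the trace of `S`; a second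
  -- contraction gives `τ = 2(m - 1) s`. Solving for `S` needs `m ≠ 1, 2`.
  have hric : ∀ Y Z, ricci (form G) x Y Z = s * G x Y Z + ((m : ℝ) - 2) * S Y Z := by
    intro Y Z
    have hB : (fun X U => riemann (form G) x X Y Z U) = fun X U =>
        1 * (G x Y Z * S X U + S Y Z * form G x X U) +
          (-1) * (1 * (G x Z X * S Y U) + 1 * (S Z X * G x Y U)) := by
      funext X U
      rw [h, psi₁, form, hs Z X, hS Z X]
      ring
    rw [ricci, hB, hadd (fun X U => G x Y Z * S X U + S Y Z * form G x X U)
      (fun X U => 1 * (G x Z X * S Y U) + 1 * (S Z X * G x Y U)),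
      hadd (fun X U => S X U) (form G x), hadd (fun X U => G x Z X * S Y U)
      (fun X U => S Z X * G x Y U), metricTrace_mul (G x Z) (S Y), metricTrace_mul (S Z) (G x Y),
      metricTrace_self hs hnd, sharp_apply_apply hs hnd, hs Z, apply_sharp hs hnd, hS Z Y]
    ring
  have hτ : scalarCurvature (form G) x = 2 * ((m : ℝ) - 1) * s := by
    have hB : ricci (form G) x = fun Y Z => s * form G x Y Z + ((m : ℝ) - 2) * S Y Z := by
      funext Y Z
      exact hric Y Z
    rw [scalarCurvature, hB, hadd (form G x) (fun Y Z => S Y Z), metricTrace_self hs hnd]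
    ring
  have hm' : (2 : ℝ) < m := by exact_mod_cast hm
  have h1 : (m : ℝ) - 1 ≠ 0 := by linarith
  have h2 : (m : ℝ) - 2 ≠ 0 := by linarith
  rw [h, hτ, psi₁, psi₁, pi₁, hric, hric, hric, hric]
  field_simp
  ring

end Pointwise

/-! ### Smoothness and metricity of the Levi-Civita connection. -/

section Smooth

set_option maxSynthPendingDepth 3

variable {G : (𝔼 m) → (𝔼 m) →L[ℝ] (𝔼 m) →L[ℝ] ℝ} {U : Set (𝔼 m)}

theorem contDiffOn_det {F : Type*} [NormedAddCommGroup F] [NormedSpace ℝ F] {U : Set F}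
    {M : F → Matrix (Fin m) (Fin m) ℝ} (hM : ∀ i j, ContDiffOn ℝ ∞ (fun x => M x i j) U) :
    ContDiffOn ℝ ∞ (fun x => (M x).det) U := by
  simp only [Matrix.det_apply]
  refine ContDiffOn.sum fun σ _ => ContDiffOn.const_smul _ ?_
  exact contDiffOn_prod fun i _ => hM _ _

theorem contDiffOn_gInv (hG : ContDiffOn ℝ ∞ G U)
    (hnd : ∀ x ∈ U, ∀ v, (∀ w, G x v w = 0) → v = 0) (i j : Fin m) :
    ContDiffOn ℝ ∞ (fun x => gInv (form G) x i j) U := by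
  have hM : ∀ a b, ContDiffOn ℝ ∞
      (fun x => (Matrix.of fun a b : Fin m => form G x (e a) (e b)) a b) U := fun a b =>
    (hG.clm_apply contDiffOn_const).clm_apply contDiffOn_const
  simp only [gInv, Matrix.inv_def, Ring.inverse_eq_inv', Matrix.smul_apply, smul_eq_mul,
    Matrix.adjugate_apply]
  refine ContDiffOn.mul ((contDiffOn_det hM).inv fun x hx => gram_det_ne_zero (hnd x hx))
    (contDiffOn_det fun a b => ?_)
  simp only [Matrix.updateRow_apply]
  split_ifs
  · exact contDiffOn_const
  · exact hM a b

theorem contDiffOn_sharp (hG : ContDiffOn ℝ ∞ G U)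
    (hnd : ∀ x ∈ U, ∀ v, (∀ w, G x v w = 0) → v = 0) : ContDiffOn ℝ ∞ (sharp G) U := by
  unfold sharp
  exact ContDiffOn.sum fun k _ => ContDiffOn.sum fun l _ =>
    (contDiffOn_gInv hG hnd k l).smul contDiffOn_const

/-- The Christoffel symbols of the first kind as a field of trilinear forms. -/
def christoffelForm (G : (𝔼 m) → (𝔼 m) →L[ℝ] (𝔼 m) →L[ℝ] ℝ) (x : (𝔼 m)) : (𝔼 m) →L[ℝ] (𝔼 m) →L[ℝ] (𝔼 m) →L[ℝ] ℝ :=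
  (1 / 2 : ℝ) • (fderiv ℝ G x + (fderiv ℝ G x).flip
    - ((ContinuousLinearMap.flipₗᵢ ℝ (𝔼 m) (𝔼 m) ℝ).toContinuousLinearEquiv :
        ((𝔼 m) →L[ℝ] (𝔼 m) →L[ℝ] ℝ) →L[ℝ] (𝔼 m) →L[ℝ] (𝔼 m) →L[ℝ] ℝ).comp (fderiv ℝ G x).flip)

theorem christoffelForm_apply (x u v w : (𝔼 m)) :
    christoffelForm G x u v w = 1 / 2 *
      (fderiv ℝ G x u v w + fderiv ℝ G x v u w - fderiv ℝ G x w u v) := by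
  simp [christoffelForm]

/-- The Levi-Civita connection as a field of bilinear maps. -/
def leviCivita (G : (𝔼 m) → (𝔼 m) →L[ℝ] (𝔼 m) →L[ℝ] ℝ) (x : (𝔼 m)) : (𝔼 m) →L[ℝ] (𝔼 m) →L[ℝ] (𝔼 m) :=
  (ContinuousLinearMap.compL ℝ (𝔼 m) ((𝔼 m) →L[ℝ] ℝ) (𝔼 m) (sharp G x)).comp (christoffelForm G x)

theorem leviCivita_apply (x u v : (𝔼 m)) :
    leviCivita G x u v = sharp G x (christoffelForm G x u v) := rfl

theorem christoffel_eq_leviCivita {x : (𝔼 m)} (hG : DifferentiableAt ℝ G x) (u v : (𝔼 m)) :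
    christoffel (form G) x u v = leviCivita G x u v := by
  rw [leviCivita_apply, sharp_apply, christoffel]
  simp only [christoffel₁, fderiv_clm_apply₂ hG, christoffelForm_apply]

theorem contDiffOn_leviCivita (hU : IsOpen U) (hG : ContDiffOn ℝ ∞ G U)
    (hnd : ∀ x ∈ U, ∀ v, (∀ w, G x v w = 0) → v = 0) : ContDiffOn ℝ ∞ (leviCivita G) U := by
  have hD : ContDiffOn ℝ ∞ (fderiv ℝ G) U := hG.fderiv_of_isOpen hU (by simp)
  simp only [contDiffOn_clm_apply]
  intro u v
  simp only [leviCivita_apply]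
  refine (contDiffOn_sharp hG hnd).clm_apply ?_
  rw [contDiffOn_clm_apply]
  intro w
  simp only [christoffelForm_apply]
  have h : ∀ a b c : (𝔼 m), ContDiffOn ℝ ∞ (fun x => fderiv ℝ G x a b c) U := fun a b c =>
    ((hD.clm_apply contDiffOn_const).clm_apply contDiffOn_const).clm_apply contDiffOn_const
  exact contDiffOn_const.mul (((h _ _ _).add (h _ _ _)).sub (h _ _ _))

theorem fderiv_metric_symm (hU : IsOpen U) (hG : ContDiffOn ℝ ∞ G U)
    (hs : ∀ x ∈ U, ∀ v w, G x v w = G x w v) {x : (𝔼 m)} (hx : x ∈ U) (u v w : (𝔼 m)) :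
    fderiv ℝ G x u v w = fderiv ℝ G x u w v := by
  have hd : DifferentiableAt ℝ G x :=
    (hG.contDiffAt (hU.mem_nhds hx)).differentiableAt (by simp)
  rw [← fderiv_clm_apply₂ hd, ← fderiv_clm_apply₂ hd]
  have h : (fun y => G y v w) =ᶠ[nhds x] fun y => G y w v :=
    Filter.mem_of_superset (hU.mem_nhds hx) fun y hy => hs y hy v w
  rw [h.fderiv_eq]

theorem leviCivita_symm (hU : IsOpen U) (hG : ContDiffOn ℝ ∞ G U)
    (hs : ∀ x ∈ U, ∀ v w, G x v w = G x w v) {x : (𝔼 m)} (hx : x ∈ U) (u v : (𝔼 m)) :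
    leviCivita G x u v = leviCivita G x v u := by
  rw [leviCivita_apply, leviCivita_apply]
  congr 1
  ext w
  rw [christoffelForm_apply, christoffelForm_apply, fderiv_metric_symm hU hG hs hx w u v]
  ring

/-- In the sum of the two first-kind symbols, symmetry of `G` cancels the derivatives along `v` and
`w`. -/
theorem leviCivita_metric (hU : IsOpen U) (hG : ContDiffOn ℝ ∞ G U)
    (hs : ∀ x ∈ U, ∀ v w, G x v w = G x w v)
    (hnd : ∀ x ∈ U, ∀ v, (∀ w, G x v w = 0) → v = 0) {x : (𝔼 m)} (hx : x ∈ U) (u v w : (𝔼 m)) :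
    fderiv ℝ G x u v w = G x (leviCivita G x u v) w + G x v (leviCivita G x u w) := by
  have h := fderiv_metric_symm hU hG hs hx
  rw [hs x hx v, leviCivita_apply, leviCivita_apply, apply_sharp (hs x hx) (hnd x hx),
    apply_sharp (hs x hx) (hnd x hx), christoffelForm_apply, christoffelForm_apply,
    h v u w, h u w v, h w u v]
  ring

theorem curvature_eq (hU : IsOpen U) (hG : ContDiffOn ℝ ∞ G U)
    (hnd : ∀ x ∈ U, ∀ v, (∀ w, G x v w = 0) → v = 0) {x : (𝔼 m)} (hx : x ∈ U) (u v w : (𝔼 m)) :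
    curvature (form G) x u v w = connectionCurvature (leviCivita G) x u v w := by
  have hGd : ∀ y ∈ U, DifferentiableAt ℝ G y := fun y hy =>
    (hG.contDiffAt (hU.mem_nhds hy)).differentiableAt (by simp)
  have hΓ : DifferentiableAt ℝ (leviCivita G) x :=
    ((contDiffOn_leviCivita hU hG hnd).contDiffAt (hU.mem_nhds hx)).differentiableAt (by simp)
  have hd : ∀ a b c, fderiv ℝ (fun y => christoffel (form G) y b c) x a =
      fderiv ℝ (leviCivita G) x a b c := by
    intro a b c
    rw [← fderiv_clm_apply₂ hΓ]
    have h : (fun y => christoffel (form G) y b c) =ᶠ[nhds x] fun y => leviCivita G y b c :=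
      Filter.mem_of_superset (hU.mem_nhds hx) fun y hy => christoffel_eq_leviCivita (hGd y hy) b c
    rw [h.fderiv_eq]
  simp only [curvature, connectionCurvature, hd, christoffel_eq_leviCivita (hGd x hx)]

end Smooth

end LocalMetric

/-! ### The class conditions as commutators with the conformal difference tensor. -/

section ConformalCommutator

set_option maxSynthPendingDepth 3

variable {E : Type*} [NormedAddCommGroup E] [NormedSpace ℝ E]
  {g : E →L[ℝ] E →L[ℝ] ℝ} {J : E →L[ℝ] E} {θ η : E →L[ℝ] ℝ} {P N u v : E} {c : ℝ}

/-- With `η = -c θ ∘ J` one has `c θ = η ∘ J`, and the right side of `hN` becomes the pairing of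
`[J, A(u, ·)] v` with `w`. In the skew-Hermitian case below, the opposite sign of `η` compensates
for `J` being self-adjoint. -/
theorem eq_conformalDiff_comm_of_hermitian (hnd : ∀ v, (∀ w, g v w = 0) → v = 0)
    (hJ : ∀ v, J (J v) = -v) (hg : ∀ v w, g (J v) w = -g v (J w)) (hP : ∀ v, g P v = η v)
    (hη : ∀ v, η v = -(c * θ (J v)))
    (hN : ∀ w, g N w = c * (g u v * θ w - g u w * θ v - g u (J v) * θ (J w)
      + g u (J w) * θ (J v))) :
    N = J (conformalDiff g η P u v) - conformalDiff g η P u (J v) := by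
  rw [← sub_eq_zero]
  refine hnd _ fun w => ?_
  simp only [conformalDiff, map_add, map_sub, map_smul, add_apply, sub_apply, smul_apply,
    smul_eq_mul, hg, hP, hN, hη, hJ, map_neg]
  ring

theorem eq_conformalDiff_comm_of_skewHermitian (hnd : ∀ v, (∀ w, g v w = 0) → v = 0)
    (hJ : ∀ v, J (J v) = -v) (hg : ∀ v w, g (J v) w = g v (J w)) (hP : ∀ v, g P v = η v)
    (hη : ∀ v, η v = c * θ (J v))
    (hN : ∀ w, g N w = c * (g u v * θ w + g u w * θ v + g u (J v) * θ (J w)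
      + g u (J w) * θ (J v))) :
    N = J (conformalDiff g η P u v) - conformalDiff g η P u (J v) := by
  rw [← sub_eq_zero]
  refine hnd _ fun w => ?_
  simp only [conformalDiff, map_add, map_sub, map_smul, add_apply, sub_apply, smul_apply,
    smul_eq_mul, hg, hP, hN, hη, hJ, map_neg]
  ring

/-- `conformalDiff` as a continuous bilinear map. -/
def conformalDiffL (g : E →L[ℝ] E →L[ℝ] ℝ) (η : E →L[ℝ] ℝ) (P : E) : E →L[ℝ] E →L[ℝ] E :=
  η.smulRight (ContinuousLinearMap.id ℝ E) + (η.smulRight (ContinuousLinearMap.id ℝ E)).flip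
    - (ContinuousLinearMap.compL ℝ E ℝ E (ContinuousLinearMap.toSpanSingleton ℝ P)).comp g

theorem conformalDiffL_apply (g : E →L[ℝ] E →L[ℝ] ℝ) (η : E →L[ℝ] ℝ) (P u v : E) :
    conformalDiffL g η P u v = conformalDiff g η P u v := by
  simp [conformalDiffL, conformalDiff]

theorem conformalDiff_symm (hs : ∀ v w, g v w = g w v) (u v : E) :
    conformalDiff g η P u v = conformalDiff g η P v u := by
  rw [conformalDiff, conformalDiff, hs u v, add_comm (η u • v)]

end ConformalCommutator

/-! ### The flat connection of a `𝒲⁰`-structure on a coordinate domain. -/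

namespace LocalMetric

variable {m : ℕ}

local notation "𝔼" m:max => EuclideanSpace ℝ (Fin m)

/-- A field of continuous endomorphisms as a function of a point and a vector. -/
abbrev endo (J : (𝔼 m) → (𝔼 m) →L[ℝ] (𝔼 m)) : (𝔼 m) → (𝔼 m) → (𝔼 m) := fun x v => J x v

/-- The covariant derivative `(∇_u J) v` with respect to the Levi-Civita connection. -/
def covDerivEnd (G : (𝔼 m) → (𝔼 m) →L[ℝ] (𝔼 m) →L[ℝ] ℝ) (J : (𝔼 m) → (𝔼 m) →L[ℝ] (𝔼 m))
    (x u v : 𝔼 m) : 𝔼 m :=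
  fderiv ℝ J x u v + leviCivita G x u (J x v) - J x (leviCivita G x u v)

/-- The structural 1-form as a field of continuous linear forms. -/
def lieForm (G : (𝔼 m) → (𝔼 m) →L[ℝ] (𝔼 m) →L[ℝ] ℝ) (J : (𝔼 m) → (𝔼 m) →L[ℝ] (𝔼 m))
    (x : 𝔼 m) : (𝔼 m) →L[ℝ] ℝ :=
  ∑ i, ∑ j, gInv (form G) x i j • G x (covDerivEnd G J x (e i) (e j))

variable {G : (𝔼 m) → (𝔼 m) →L[ℝ] (𝔼 m) →L[ℝ] ℝ} {J : (𝔼 m) → (𝔼 m) →L[ℝ] (𝔼 m)}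
  {U : Set (𝔼 m)}

theorem nablaEnd_eq {x : 𝔼 m} (hG : DifferentiableAt ℝ G x) (hJ : DifferentiableAt ℝ J x)
    (u v : 𝔼 m) : nablaEnd (form G) (endo J) x u v = covDerivEnd G J x u v := by
  rw [nablaEnd, covDerivEnd, christoffel_eq_leviCivita hG, christoffel_eq_leviCivita hG,
    fderiv_clm_apply hJ (differentiableAt_const v)]
  simp

theorem structuralForm_eq {x : 𝔼 m} (hG : DifferentiableAt ℝ G x) (hJ : DifferentiableAt ℝ J x)
    (z : 𝔼 m) : structuralForm (form G) (endo J) x z = lieForm G J x z := by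
  simp [structuralForm, metricTrace, structuralTensor, nablaEnd_eq hG hJ, lieForm]

set_option maxSynthPendingDepth 3 in
theorem contDiffOn_lieForm (hU : IsOpen U) (hG : ContDiffOn ℝ ∞ G U) (hJ : ContDiffOn ℝ ∞ J U)
    (hnd : ∀ x ∈ U, ∀ v, (∀ w, G x v w = 0) → v = 0) : ContDiffOn ℝ ∞ (lieForm G J) U := by
  have hD : ContDiffOn ℝ ∞ (fderiv ℝ J) U := hJ.fderiv_of_isOpen hU (by simp)
  have hΓ := contDiffOn_leviCivita hU hG hnd
  unfold lieForm
  refine ContDiffOn.sum fun i _ => ContDiffOn.sum fun j _ =>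
    (contDiffOn_gInv hG hnd i j).smul (hG.clm_apply ?_)
  unfold covDerivEnd
  exact (((hD.clm_apply contDiffOn_const).clm_apply contDiffOn_const).add
    ((hΓ.clm_apply contDiffOn_const).clm_apply (hJ.clm_apply contDiffOn_const))).sub
    (hJ.clm_apply ((hΓ.clm_apply contDiffOn_const).clm_apply contDiffOn_const))

set_option maxSynthPendingDepth 3 in
/-- The covariant derivative of the product of two fields of endomorphisms. -/
theorem covDerivEnd_comp {J₁ J₂ J₃ : (𝔼 m) → (𝔼 m) →L[ℝ] (𝔼 m)} {x : 𝔼 m}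
    (h₁ : DifferentiableAt ℝ J₁ x) (h₂ : DifferentiableAt ℝ J₂ x) (h₃ : DifferentiableAt ℝ J₃ x)
    (h : ∀ᶠ y in nhds x, ∀ v, J₃ y v = J₁ y (J₂ y v)) (u v : 𝔼 m) :
    covDerivEnd G J₃ x u v =
      covDerivEnd G J₁ x u (J₂ x v) + J₁ x (covDerivEnd G J₂ x u v) := by
  have hx := h.self_of_nhds
  have hd : fderiv ℝ J₃ x u v = fderiv ℝ J₁ x u (J₂ x v) + J₁ x (fderiv ℝ J₂ x u v) := by
    have e₃ : fderiv ℝ (fun y => J₃ y v) x u = fderiv ℝ J₃ x u v := by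
      rw [fderiv_clm_apply h₃ (differentiableAt_const v)]
      simp
    have h' : (fun y => J₃ y v) =ᶠ[nhds x] fun y => J₁ y (J₂ y v) := h.mono fun y hy => hy v
    rw [← e₃, h'.fderiv_eq,
      fderiv_clm_apply h₁ (h₂.clm_apply (differentiableAt_const v)),
      fderiv_clm_apply h₂ (differentiableAt_const v)]
    simp [add_comm]
  simp only [covDerivEnd, hd, hx, map_add, map_sub]
  abel

set_option maxSynthPendingDepth 3 in
/-- A metric with a compatible quaternionic structure of class `𝒲⁰` has curvature `ψ₁(S)`. -/
theorem exists_riemann_eq_psi {J₁ J₂ J₃ : (𝔼 m) → (𝔼 m) →L[ℝ] (𝔼 m)} {c₁ c₂ c₃ : ℝ}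
    (hU : IsOpen U) (hG : ContDiffOn ℝ ∞ G U) (hJ₁ : ContDiffOn ℝ ∞ J₁ U)
    (hJ₂ : ContDiffOn ℝ ∞ J₂ U) (hJ₃ : ContDiffOn ℝ ∞ J₃ U)
    (hs : ∀ x ∈ U, ∀ v w, G x v w = G x w v)
    (hnd : ∀ x ∈ U, ∀ v, (∀ w, G x v w = 0) → v = 0)
    (h₁ : ∀ x ∈ U, ∀ v, J₁ x (J₁ x v) = -v) (h₂ : ∀ x ∈ U, ∀ v, J₂ x (J₂ x v) = -v)
    (h₃ : ∀ x ∈ U, ∀ v, J₃ x v = J₁ x (J₂ x v))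
    (h₁₂ : ∀ x ∈ U, ∀ v, J₂ x (J₁ x v) = -J₁ x (J₂ x v))
    (g₁ : ∀ x ∈ U, ∀ v w, G x (J₁ x v) w = -G x v (J₁ x w))
    (g₂ : ∀ x ∈ U, ∀ v w, G x (J₂ x v) w = G x v (J₂ x w))
    (g₃ : ∀ x ∈ U, ∀ v w, G x (J₃ x v) w = G x v (J₃ x w))
    (hW₁ : ∀ p ∈ U, ∀ x y z, structuralTensor (form G) (endo J₁) p x y z = c₁ *
      (G p x y * structuralForm (form G) (endo J₁) p z
        - G p x z * structuralForm (form G) (endo J₁) p y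
        - G p x (J₁ p y) * structuralForm (form G) (endo J₁) p (J₁ p z)
        + G p x (J₁ p z) * structuralForm (form G) (endo J₁) p (J₁ p y)))
    (hW₂ : ∀ p ∈ U, ∀ x y z, structuralTensor (form G) (endo J₂) p x y z = c₂ *
      (G p x y * structuralForm (form G) (endo J₂) p z
        + G p x z * structuralForm (form G) (endo J₂) p y
        + G p x (J₂ p y) * structuralForm (form G) (endo J₂) p (J₂ p z)
        + G p x (J₂ p z) * structuralForm (form G) (endo J₂) p (J₂ p y)))
    (hW₃ : ∀ p ∈ U, ∀ x y z, structuralTensor (form G) (endo J₃) p x y z = c₃ *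
      (G p x y * structuralForm (form G) (endo J₃) p z
        + G p x z * structuralForm (form G) (endo J₃) p y
        + G p x (J₃ p y) * structuralForm (form G) (endo J₃) p (J₃ p z)
        + G p x (J₃ p z) * structuralForm (form G) (endo J₃) p (J₃ p y)))
    (hclosed : ∀ p ∈ U, ExtDerivVanishesAt
      (fun y v => structuralForm (form G) (endo J₁) y (endo J₁ y v)) p)
    {p : 𝔼 m} (hp : p ∈ U) :
    ∃ S : (𝔼 m) →L[ℝ] (𝔼 m) →L[ℝ] ℝ, (∀ v w, S v w = S w v) ∧
      ∀ X Y Z V, riemann (form G) p X Y Z V = psi₁ (form G) (fun _ v w => S v w) p X Y Z V := by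
  have dG : ∀ x ∈ U, DifferentiableAt ℝ G x := fun x hx =>
    (hG.contDiffAt (hU.mem_nhds hx)).differentiableAt (by simp)
  have dJ₁ : ∀ x ∈ U, DifferentiableAt ℝ J₁ x := fun x hx =>
    (hJ₁.contDiffAt (hU.mem_nhds hx)).differentiableAt (by simp)
  have dJ₂ : ∀ x ∈ U, DifferentiableAt ℝ J₂ x := fun x hx =>
    (hJ₂.contDiffAt (hU.mem_nhds hx)).differentiableAt (by simp)
  have dJ₃ : ∀ x ∈ U, DifferentiableAt ℝ J₃ x := fun x hx =>
    (hJ₃.contDiffAt (hU.mem_nhds hx)).differentiableAt (by simp)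
  have h₃₃ : ∀ x ∈ U, ∀ v, J₃ x (J₃ x v) = -v := fun x hx v => by
    rw [h₃ x hx, h₃ x hx, h₁₂ x hx, map_neg, h₁ x hx, neg_neg, h₂ x hx]
  set η₁ : (𝔼 m) → (𝔼 m) →L[ℝ] ℝ := fun x => (-c₁) • (lieForm G J₁ x).comp (J₁ x) with hη₁
  set η₂ : (𝔼 m) → (𝔼 m) →L[ℝ] ℝ := fun x => c₂ • (lieForm G J₂ x).comp (J₂ x) with hη₂
  set η₃ : (𝔼 m) → (𝔼 m) →L[ℝ] ℝ := fun x => c₃ • (lieForm G J₃ x).comp (J₃ x) with hη₃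
  have hsharp : ∀ x ∈ U, ∀ (α : (𝔼 m) →L[ℝ] ℝ) v, G x (sharp G x α) v = α v := fun x hx α v => by
    rw [apply_sharp (hs x hx) (hnd x hx)]
  have N₁ : ∀ x ∈ U, ∀ u v, covDerivEnd G J₁ x u v =
      J₁ x (conformalDiff (G x) (η₁ x) (sharp G x (η₁ x)) u v)
        - conformalDiff (G x) (η₁ x) (sharp G x (η₁ x)) u (J₁ x v) := fun x hx u v =>
    eq_conformalDiff_comm_of_hermitian (c := c₁) (θ := lieForm G J₁ x) (hnd x hx) (h₁ x hx)
      (g₁ x hx) (hsharp x hx _) (fun v => by simp [hη₁]) fun w => by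
        simpa only [structuralTensor, nablaEnd_eq (dG x hx) (dJ₁ x hx),
          structuralForm_eq (dG x hx) (dJ₁ x hx)] using hW₁ x hx u v w
  have N₂ : ∀ x ∈ U, ∀ u v, covDerivEnd G J₂ x u v =
      J₂ x (conformalDiff (G x) (η₂ x) (sharp G x (η₂ x)) u v)
        - conformalDiff (G x) (η₂ x) (sharp G x (η₂ x)) u (J₂ x v) := fun x hx u v =>
    eq_conformalDiff_comm_of_skewHermitian (c := c₂) (θ := lieForm G J₂ x) (hnd x hx) (h₂ x hx)
      (g₂ x hx) (hsharp x hx _) (fun v => by simp [hη₂]) fun w => by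
        simpa only [structuralTensor, nablaEnd_eq (dG x hx) (dJ₂ x hx),
          structuralForm_eq (dG x hx) (dJ₂ x hx)] using hW₂ x hx u v w
  have N₃ : ∀ x ∈ U, ∀ u v, covDerivEnd G J₃ x u v =
      J₃ x (conformalDiff (G x) (η₃ x) (sharp G x (η₃ x)) u v)
        - conformalDiff (G x) (η₃ x) (sharp G x (η₃ x)) u (J₃ x v) := fun x hx u v =>
    eq_conformalDiff_comm_of_skewHermitian (c := c₃) (θ := lieForm G J₃ x) (hnd x hx) (h₃₃ x hx)
      (g₃ x hx) (hsharp x hx _) (fun v => by simp [hη₃]) fun w => by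
        simpa only [structuralTensor, nablaEnd_eq (dG x hx) (dJ₃ x hx),
          structuralForm_eq (dG x hx) (dJ₃ x hx)] using hW₃ x hx u v w
  have hη : ∀ x ∈ U, η₁ x = η₃ x ∧ η₂ x = η₃ x := fun x hx => by
    refine quaternionic_forms_eq (hs x hx) (hnd x hx) (h₁ x hx) (h₂ x hx) (h₃ x hx) (h₁₂ x hx)
      (g₁ x hx) (g₂ x hx) (hsharp x hx _) (hsharp x hx _) (hsharp x hx _) fun u v => ?_
    have := covDerivEnd_comp (G := G) (dJ₁ x hx) (dJ₂ x hx) (dJ₃ x hx)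
      (Filter.mem_of_superset (hU.mem_nhds hx) h₃) u v
    rw [N₁ x hx, N₂ x hx, N₃ x hx] at this
    -- The commutators here are `J A - A J`, whereas `quaternionic_forms_eq` takes `A J - J A`.
    rw [← neg_sub, this, ← neg_sub (J₁ x _), ← neg_sub (J₂ x _), map_neg]
    abel
  set P : (𝔼 m) → 𝔼 m := fun x => sharp G x (η₁ x) with hP
  set Γ := leviCivita G with hΓ
  set Δ : (𝔼 m) → (𝔼 m) →L[ℝ] (𝔼 m) →L[ℝ] (𝔼 m) :=
    fun x => Γ x + conformalDiffL (G x) (η₁ x) (P x) with hΔ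
  have Δ_apply : ∀ x u v, Δ x u v = Γ x u v + conformalDiff (G x) (η₁ x) (P x) u v :=
    fun x u v => by simp [hΔ, conformalDiffL_apply]
  have sΓ : ContDiffOn ℝ ∞ Γ U := contDiffOn_leviCivita hU hG hnd
  have sη : ContDiffOn ℝ ∞ η₁ U :=
    ((contDiffOn_lieForm hU hG hJ₁ hnd).clm_comp hJ₁).const_smul (-c₁)
  have sP : ContDiffOn ℝ ∞ P U := (contDiffOn_sharp hG hnd).clm_apply sη
  have sΔ : ContDiffOn ℝ ∞ Δ U := by
    simp only [contDiffOn_clm_apply, Δ_apply, conformalDiff]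
    intro u v
    exact ((sΓ.clm_apply contDiffOn_const).clm_apply contDiffOn_const).add
      ((((sη.clm_apply contDiffOn_const).smul contDiffOn_const).add
        ((sη.clm_apply contDiffOn_const).smul contDiffOn_const)).sub
        (((hG.clm_apply contDiffOn_const).clm_apply contDiffOn_const).smul sP))
  have hUp := hU.mem_nhds hp
  have two_le : (2 : WithTop ℕ∞) ≤ ∞ :=
    WithTop.coe_le_coe.2 (le_top : (2 : ℕ∞) ≤ ⊤)
  have dΓ : DifferentiableAt ℝ Γ p := (sΓ.contDiffAt hUp).differentiableAt (by simp)
  have dΔ : DifferentiableAt ℝ Δ p := (sΔ.contDiffAt hUp).differentiableAt (by simp)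
  have dη : DifferentiableAt ℝ η₁ p := (sη.contDiffAt hUp).differentiableAt (by simp)
  have dP : DifferentiableAt ℝ P p := (sP.contDiffAt hUp).differentiableAt (by simp)
  have hΓs : ∀ x ∈ U, ∀ u v, Γ x u v = Γ x v u := fun x hx => leviCivita_symm hU hG hs hx
  have hΓG : ∀ x ∈ U, ∀ u v w,
      fderiv ℝ G x u v w = G x (Γ x u v) w + G x v (Γ x u w) :=
    fun x hx => leviCivita_metric hU hG hs hnd hx
  have hΔs : ∀ x ∈ U, ∀ u v, Δ x u v = Δ x v u := fun x hx u v => by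
    rw [Δ_apply, Δ_apply, hΓs x hx, conformalDiff_symm (hs x hx)]
  -- With a common `η`, `∇J = [J, A]` says that `J` is parallel for `Δ = Γ + A`.
  have par₂ : ∀ x ∈ U, ∀ u v, fderiv ℝ J₂ x u v = J₂ x (Δ x u v) - Δ x u (J₂ x v) :=
    fun x hx u v => by
      have h := N₂ x hx u v
      rw [(hη x hx).2, ← (hη x hx).1, covDerivEnd, sub_eq_iff_eq_add, ← eq_sub_iff_add_eq] at h
      rw [h, Δ_apply, Δ_apply, map_add]
      abel
  have par₃ : ∀ x ∈ U, ∀ u v, fderiv ℝ J₃ x u v = J₃ x (Δ x u v) - Δ x u (J₃ x v) :=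
    fun x hx u v => by
      have h := N₃ x hx u v
      rw [← (hη x hx).1, covDerivEnd, sub_eq_iff_eq_add, ← eq_sub_iff_add_eq] at h
      rw [h, Δ_apply, Δ_apply, map_add]
      abel
  have hdη : ∀ u v, fderiv ℝ η₁ p u v = fderiv ℝ η₁ p v u := by
    have h : ∀ u v, fderiv ℝ η₁ p u v = -c₁ *
        fderiv ℝ (fun y => structuralForm (form G) (endo J₁) y (endo J₁ y v)) p u := by
      intro u v
      have h1 : (fun y => η₁ y v) =ᶠ[nhds p]
          fun y => (-c₁) • structuralForm (form G) (endo J₁) y (endo J₁ y v) :=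
        Filter.mem_of_superset hUp fun y hy => by
          simp [hη₁, structuralForm_eq (dG y hy) (dJ₁ y hy)]
      have h2 : fderiv ℝ (fun y => η₁ y v) p u = fderiv ℝ η₁ p u v := by
        rw [fderiv_clm_apply dη (differentiableAt_const v)]
        simp
      rw [← h2, h1.fderiv_eq]
      change fderiv ℝ
        ((-c₁) • fun y => structuralForm (form G) (endo J₁) y (endo J₁ y v)) p u = _
      rw [fderiv_const_smul_field]
      rfl
    intro u v
    rw [h, h, sub_eq_zero.1 (hclosed p hp u v)]
  set S := conformalHessian G Γ η₁ P p with hS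
  have hSs : ∀ v w, S v w = S w v := fun v w => by
    rw [hS, conformalHessian_apply, conformalHessian_apply, hdη v w, hΓs p hp v w, hs p hp v w]
    ring
  have hR := connectionCurvature_add_conformalDiff dΓ dΔ (dG p hp) dη dP (hs p hp) (hΓs p hp)
    (hΓG p hp) (Filter.mem_of_superset hUp fun x hx => hsharp x hx _) hdη
    (Filter.Eventually.of_forall Δ_apply)
  rw [← hS] at hR
  have hK : IsCurvatureLike fun X Y Z V => G p (connectionCurvature Δ p X Y Z) V := by
    refine ⟨fun X Y Z V => ?_, fun X Y Z V => ?_, fun X Y Z V => ?_⟩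
    · simp only [connectionCurvature]
      rw [← neg_sub, map_neg, neg_apply]
    -- `Δ` need not preserve `G`, so skewness in the last pair is read off `hR`: both the curvature
    -- of `Γ` and the `ψ₁(S)` term have it.
    · rw [hR, hR, connectionCurvature_skew dΓ ((hG.contDiffAt hUp).of_le two_le)
        (Filter.mem_of_superset hUp hΓG), hs p hp Z]
      ring
    · rw [← add_apply, ← add_apply, ← map_add, ← map_add, connectionCurvature_bianchi dΔ
        (Filter.mem_of_superset hUp hΔs), map_zero, zero_apply]
  have hK0 : ∀ X Y Z V, G p (connectionCurvature Δ p X Y Z) V = 0 := by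
    -- The witness `-J₁ v` works because `J₂ J₃ = J₂ J₁ J₂ = J₁`.
    refine hK.eq_zero_of_pure (J₂ := J₂ p) (J₃ := J₃ p) (fun X Y Z V => ?_) (fun X Y Z V => ?_)
      (fun v => ?_) (fun v => ⟨-J₁ p v, ?_⟩) (fun X Y Z V => ?_)
    · rw [connectionCurvature_comm dΔ ((hJ₂.contDiffAt hUp).of_le two_le)
        (Filter.mem_of_superset hUp par₂), g₂ p hp]
    · rw [connectionCurvature_comm dΔ ((hJ₃.contDiffAt hUp).of_le two_le)
        (Filter.mem_of_superset hUp par₃), g₃ p hp]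
    · rw [h₃ p hp, h₃ p hp, h₁₂ p hp, neg_neg]
    · rw [h₃ p hp, h₁₂ p hp, h₂ p hp, map_neg, map_neg, neg_neg, h₁ p hp, neg_neg]
    · simp only [connectionCurvature, map_neg, neg_apply, map_sub, map_add, sub_apply, add_apply]
      ring
  refine ⟨S, hSs, fun X Y Z V => ?_⟩
  have := hR X Y Z V
  rw [hK0] at this
  rw [riemann, curvature_eq hU hG hnd hp, psi₁]
  linarith

end LocalMetric

/-! ### Transfer of the pointwise algebra to charts, and the theorem. -/

namespace AlmostHGStructure

variable {n : ℕ} {M : Type*} [TopologicalSpace M]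
  [ChartedSpace (EuclideanSpace ℝ (Fin (4 * n))) M] [IsManifold (𝓡 (4 * n)) ∞ M]

local notation "𝔼" => EuclideanSpace ℝ (Fin (4 * n))

theorem localEndL_localEndL {φ : OpenPartialHomeomorph M 𝔼}
    (hφ : φ ∈ IsManifold.maximalAtlas (𝓡 (4 * n)) ∞ M)
    (J J' : ∀ p : M, TangentSpace (𝓡 (4 * n)) p →L[ℝ] TangentSpace (𝓡 (4 * n)) p) {x : 𝔼}
    (hx : x ∈ φ.target) (v : 𝔼) :
    localEndL J φ x (localEndL J' φ x v) = mfderiv (𝓡 (4 * n)) (𝓡 (4 * n)) φ (φ.symm x)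
      (J (φ.symm x) (J' (φ.symm x) (mfderiv (𝓡 (4 * n)) (𝓡 (4 * n)) φ.symm x v))) :=
  congrArg (fun u => mfderiv (𝓡 (4 * n)) (𝓡 (4 * n)) φ (φ.symm x) (J (φ.symm x) u))
    (mfderiv_symm_mfderiv_chart hφ hx _)

theorem localFormL_localEndL {φ : OpenPartialHomeomorph M 𝔼}
    (hφ : φ ∈ IsManifold.maximalAtlas (𝓡 (4 * n)) ∞ M)
    (b : ∀ p : M, TangentSpace (𝓡 (4 * n)) p →L[ℝ] TangentSpace (𝓡 (4 * n)) p →L[ℝ] ℝ)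
    (J : ∀ p : M, TangentSpace (𝓡 (4 * n)) p →L[ℝ] TangentSpace (𝓡 (4 * n)) p) {x : 𝔼}
    (hx : x ∈ φ.target) (v w : 𝔼) :
    localFormL b φ x (localEndL J φ x v) w =
      b (φ.symm x) (J (φ.symm x) (mfderiv (𝓡 (4 * n)) (𝓡 (4 * n)) φ.symm x v))
        (mfderiv (𝓡 (4 * n)) (𝓡 (4 * n)) φ.symm x w) :=
  congrArg (fun u => b (φ.symm x) u (mfderiv (𝓡 (4 * n)) (𝓡 (4 * n)) φ.symm x w))
    (mfderiv_symm_mfderiv_chart hφ hx _)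

theorem localFormL_localEndL_right {φ : OpenPartialHomeomorph M 𝔼}
    (hφ : φ ∈ IsManifold.maximalAtlas (𝓡 (4 * n)) ∞ M)
    (b : ∀ p : M, TangentSpace (𝓡 (4 * n)) p →L[ℝ] TangentSpace (𝓡 (4 * n)) p →L[ℝ] ℝ)
    (J : ∀ p : M, TangentSpace (𝓡 (4 * n)) p →L[ℝ] TangentSpace (𝓡 (4 * n)) p) {x : 𝔼}
    (hx : x ∈ φ.target) (v w : 𝔼) :
    localFormL b φ x v (localEndL J φ x w) =
      b (φ.symm x) (mfderiv (𝓡 (4 * n)) (𝓡 (4 * n)) φ.symm x v)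
        (J (φ.symm x) (mfderiv (𝓡 (4 * n)) (𝓡 (4 * n)) φ.symm x w)) :=
  congrArg (fun u => b (φ.symm x) (mfderiv (𝓡 (4 * n)) (𝓡 (4 * n)) φ.symm x v) u)
    (mfderiv_symm_mfderiv_chart hφ hx _)

variable (S : AlmostHGStructure n M)

theorem J₃_sq (p : M) (v : TangentSpace (𝓡 (4 * n)) p) : S.J₃ p (S.J₃ p v) = -v := by
  rw [S.J₃_eq, S.J₃_eq, S.J₁_J₂ p (S.J₁ p (S.J₂ p v)), S.J₁_sq, map_neg, neg_neg, S.J₂_sq]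

theorem g_J₁ (p : M) (v w : TangentSpace (𝓡 (4 * n)) p) :
    S.g p (S.J₁ p v) w = -S.g p v (S.J₁ p w) := by
  rw [← S.hermitian_J₁ p v, S.J₁_sq, map_neg, neg_neg]

theorem g_J₂ (p : M) (v w : TangentSpace (𝓡 (4 * n)) p) :
    S.g p (S.J₂ p v) w = S.g p v (S.J₂ p w) := by
  rw [← neg_neg (S.g p v _), ← S.skewHermitian_J₂ p v, S.J₂_sq, map_neg, neg_neg]

theorem g_J₃ (p : M) (v w : TangentSpace (𝓡 (4 * n)) p) :
    S.g p (S.J₃ p v) w = S.g p v (S.J₃ p w) := by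
  rw [← neg_neg (S.g p v _), ← S.skewHermitian_J₃ p v, S.J₃_sq, map_neg, neg_neg]

theorem localFormL_g_nondegenerate {φ : OpenPartialHomeomorph M 𝔼}
    (hφ : φ ∈ IsManifold.maximalAtlas (𝓡 (4 * n)) ∞ M) {x : 𝔼}
    (hx : x ∈ φ.target) (v : 𝔼) (h : ∀ w, localFormL S.g φ x v w = 0) : v = 0 := by
  have h0 : mfderiv (𝓡 (4 * n)) (𝓡 (4 * n)) φ.symm x v = 0 := by
    refine S.nondegenerate _ _ fun w => ?_
    rw [← mfderiv_symm_mfderiv_chart hφ hx w]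
    exact h _
  rw [← mfderiv_chart_mfderiv_symm hφ hx v, h0]
  exact map_zero _

theorem localEndL_J₁_sq {φ : OpenPartialHomeomorph M 𝔼}
    (hφ : φ ∈ IsManifold.maximalAtlas (𝓡 (4 * n)) ∞ M) {x : 𝔼} (hx : x ∈ φ.target) (v : 𝔼) :
    localEndL S.J₁ φ x (localEndL S.J₁ φ x v) = -v := by
  rw [localEndL_localEndL hφ _ _ hx, S.J₁_sq, map_neg, mfderiv_chart_mfderiv_symm hφ hx]
  rfl

theorem localEndL_J₂_sq {φ : OpenPartialHomeomorph M 𝔼}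
    (hφ : φ ∈ IsManifold.maximalAtlas (𝓡 (4 * n)) ∞ M) {x : 𝔼} (hx : x ∈ φ.target) (v : 𝔼) :
    localEndL S.J₂ φ x (localEndL S.J₂ φ x v) = -v := by
  rw [localEndL_localEndL hφ _ _ hx, S.J₂_sq, map_neg, mfderiv_chart_mfderiv_symm hφ hx]
  rfl

theorem localEndL_J₃_eq {φ : OpenPartialHomeomorph M 𝔼}
    (hφ : φ ∈ IsManifold.maximalAtlas (𝓡 (4 * n)) ∞ M) {x : 𝔼} (hx : x ∈ φ.target) (v : 𝔼) :
    localEndL S.J₃ φ x v = localEndL S.J₁ φ x (localEndL S.J₂ φ x v) := by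
  rw [localEndL_localEndL hφ _ _ hx, ← S.J₃_eq]
  rfl

theorem localEndL_J₂_J₁ {φ : OpenPartialHomeomorph M 𝔼}
    (hφ : φ ∈ IsManifold.maximalAtlas (𝓡 (4 * n)) ∞ M) {x : 𝔼} (hx : x ∈ φ.target) (v : 𝔼) :
    localEndL S.J₂ φ x (localEndL S.J₁ φ x v) = -localEndL S.J₁ φ x (localEndL S.J₂ φ x v) := by
  rw [localEndL_localEndL hφ _ _ hx, localEndL_localEndL hφ _ _ hx, S.J₁_J₂, map_neg]
  exact (neg_neg _).symm

/-- In every chart, the curvature of a `𝒲⁰`-manifold is `ψ₁` of a symmetric form. -/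
theorem IsW0.exists_riemann_eq_psi {S : AlmostHGStructure n M} (hS : S.IsW0)
    {φ : OpenPartialHomeomorph M 𝔼} (hφ : φ ∈ IsManifold.maximalAtlas (𝓡 (4 * n)) ∞ M) {p : 𝔼}
    (hp : p ∈ φ.target) :
    ∃ T : 𝔼 →L[ℝ] 𝔼 →L[ℝ] ℝ, (∀ v w, T v w = T w v) ∧
      ∀ X Y Z V, LocalMetric.riemann (LocalMetric.form (localFormL S.g φ)) p X Y Z V =
        LocalMetric.psi₁ (LocalMetric.form (localFormL S.g φ)) (fun _ v w => T v w) p X Y Z V := by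
  obtain ⟨⟨hW₁, hW₂, hW₃⟩, hclosed⟩ := hS
  replace hW₁ := hW₁ φ hφ
  replace hW₂ := hW₂ φ hφ
  replace hW₃ := hW₃ φ hφ
  replace hclosed := hclosed φ hφ
  rw [localEnd_eq] at hclosed
  simp only [localEnd_eq, gLoc, localForm_eq] at hW₁ hW₂ hW₃ hclosed
  exact LocalMetric.exists_riemann_eq_psi φ.open_target
    (contDiffOn_localFormL S.contMDiff_g hφ)
    (contDiffOn_localEndL S.contMDiff_J₁ hφ) (contDiffOn_localEndL S.contMDiff_J₂ hφ)
    (contDiffOn_localEndL S.contMDiff_J₃ hφ) (fun x _ v w => S.symm _ _ _)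
    (fun x hx => S.localFormL_g_nondegenerate hφ hx)
    (fun x hx => S.localEndL_J₁_sq hφ hx) (fun x hx => S.localEndL_J₂_sq hφ hx)
    (fun x hx => S.localEndL_J₃_eq hφ hx) (fun x hx => S.localEndL_J₂_J₁ hφ hx)
    (fun x hx v w => by
      rw [localFormL_localEndL hφ _ _ hx, localFormL_localEndL_right hφ _ _ hx, S.g_J₁])
    (fun x hx v w => by
      rw [localFormL_localEndL hφ _ _ hx, localFormL_localEndL_right hφ _ _ hx, S.g_J₂])
    (fun x hx v w => by
      rw [localFormL_localEndL hφ _ _ hx, localFormL_localEndL_right hφ _ _ hx, S.g_J₃])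
    hW₁ hW₂ hW₃ hclosed hp

end AlmostHGStructure

theorem corollaryR0 (n : ℕ) (hn : 1 ≤ n) {M : Type*} [TopologicalSpace M]
    [ChartedSpace (EuclideanSpace ℝ (Fin (4 * n))) M] [IsManifold (𝓡 (4 * n)) ∞ M]
    (S : AlmostHGStructure n M) (hS : S.IsW0) :
    ∀ φ ∈ IsManifold.maximalAtlas (𝓡 (4 * n)) ∞ M, ∀ p ∈ φ.target,
      ∀ X Y Z U : EuclideanSpace ℝ (Fin (4 * n)),
        LocalMetric.riemann (S.gLoc φ) p X Y Z U =
          1 / (2 * (2 * (n : ℝ) - 1)) *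
            (LocalMetric.psi₁ (S.gLoc φ) (LocalMetric.ricci (S.gLoc φ)) p X Y Z U
              - LocalMetric.scalarCurvature (S.gLoc φ) p / (4 * (n : ℝ) - 1)
                * LocalMetric.pi₁ (S.gLoc φ) p X Y Z U) ∧
        LocalMetric.weyl (S.gLoc φ) p X Y Z U = 0 := by
  intro φ hφ p hp X Y Z U
  obtain ⟨T, hTs, hT⟩ := hS.exists_riemann_eq_psi hφ hp
  -- With `m = 4n` and `n ≥ 1` the condition `2 < m` holds; the resulting identity is the vanishing
  -- of the Weyl tensor, and the first claim is the same identity with `m - 2 = 2(2n - 1)`.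
  have h := LocalMetric.riemann_eq_of_eq_psi (x := p) (fun v w => S.symm _ _ _)
    (S.localFormL_g_nondegenerate hφ hp) hTs (by omega) hT X Y Z U
  rw [show S.gLoc φ = LocalMetric.form (AlmostHGStructure.localFormL S.g φ) from rfl, LocalMetric.weyl, sub_eq_zero]
  refine ⟨?_, h⟩
  rw [h]
  push_cast
  rw [show 2 * (2 * (n : ℝ) - 1) = 4 * n - 2 by ring]

end
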